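/- Let $G$ be a finite simple graph that is ptolemaic, i.e. chordal (it has no induced cycle on four or more vertices) and gem-free (it has no induced subgraph isomorphic to the gem, the path $P_4$ together with one further vertex adjacent to all four vertices of the path). Write "$P_4\ abcd$" for an induced path of $G$ on four vertices $a,b,c,d$ in this order. An orientation of $G$ replaces each edge $xy$ by exactly one of the arcs $x\to y$, $y\to x$; call it *opposing* if for every induced $P_4\ abcd$ of $G$ either $a\to b$ and $d\to c$, or $b\to a$ and $c\to d$. The graph $G$ is an *opposition graph* if it has an acyclic opposing orientation, and a *generalized opposition graph* if it has an opposing orientation (not necessarily acyclic). Let $\mathscr{O}(G)$ be the graph whose vertices are the ordered pairs $(x,y)$ such that $\{x,y\}$ is an end-edge of an induced $P_4$ of $G$, two vertices $(x,y)$ and $(u,v)$ being adjacent if $(x,y)=(v,u)$ or if $xyuv$ or $uvxy$ is an induced $P_4$ of $G$. For $k\ge 1$ let $\mathsf{T}_k$ be the tree on $2k+6$ vertices consisting of a path $p_0p_1\ldots p_{2k+3}$ together with one leaf attached to $p_2$ and one leaf attached to $p_{2k+1}$. Let $\mathsf{G_1}$ be the graph on $9$ vertices obtained from a triangle by attaching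 to each of its three vertices a path with two edges (one end of the path being the triangle vertex). Let $\mathsf{G_2}$ be the graph on $9$ vertices consisting of a path $q_0q_1q_2q_3q_4q_5$, two non-adjacent vertices $r$ and $s$, each adjacent to $q_2$ and $q_3$ and to no other $q_i$, and a vertex $t$ adjacent only to $s$. Then the following statements are equivalent: (i) $G$ is an opposition graph; (ii) $G$ is a generalized opposition graph; (iii) $\mathscr{O}(G)$ is bipartite; (iv) $G$ has no induced subgraph isomorphic to $\mathsf{T}_k$ for any $k\ge 1$, to $\mathsf{G_1}$, or to $\mathsf{G_2}$. -/

import Mathlib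

namespace OppositionGraph

universe u

variable {V : Type u}

/-- `H`-freeness with respect to induced subgraphs: no induced subgraph of `G` is isomorphic
to `H`. -/
def IndFree {W : Type*} (H : SimpleGraph W) (G : SimpleGraph V) : Prop :=
  ¬ H.IsIndContained G

/-! ### Ptolemaic graphs -/

/-- A graph is chordal if it has no induced cycle on four or more vertices. -/
def IsChordal (G : SimpleGraph V) : Prop :=
  ∀ k : ℕ, 4 ≤ k → IndFree (SimpleGraph.cycleGraph k) G

/-- The gem: the path `0 1 2 3` together with a vertex `4` adjacent to all of `0, 1, 2, 3`. -/
def gem : SimpleGraph (Fin 5) :=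
  SimpleGraph.fromEdgeSet
    {s(0, 1), s(1, 2), s(2, 3), s(4, 0), s(4, 1), s(4, 2), s(4, 3)}

/-- A graph is ptolemaic if it is chordal and gem-free. -/
def IsPtolemaic (G : SimpleGraph V) : Prop :=
  IsChordal G ∧ IndFree gem G

/-! ### Opposition graphs -/

/-- `a b c d` is an induced path on four vertices of `G`, in this order. -/
def IsInducedP4 (G : SimpleGraph V) (a b c d : V) : Prop :=
  a ≠ c ∧ a ≠ d ∧ b ≠ d ∧
  G.Adj a b ∧ G.Adj b c ∧ G.Adj c d ∧ ¬ G.Adj a c ∧ ¬ G.Adj a d ∧ ¬ G.Adj b d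

/-- `D` is obtained from `G` by replacing every edge `xy` by exactly one of the arcs
`x → y` and `y → x` (`D.Adj x y` means `x → y`). -/
def IsOrientation (G : SimpleGraph V) (D : Digraph V) : Prop :=
  (∀ x y, D.Adj x y → G.Adj x y) ∧
  ∀ x y, G.Adj x y → (D.Adj x y ∧ ¬ D.Adj y x) ∨ (D.Adj y x ∧ ¬ D.Adj x y)

/-- `D` has no directed cycle. -/
def IsAcyclic (D : Digraph V) : Prop :=
  ∀ x, ¬ Relation.TransGen D.Adj x x

/-- `D` orients the two end-edges of every induced path `a b c d` of `G` in opposition: both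
towards the middle of the path or both away from it. -/
def IsOpposing (G : SimpleGraph V) (D : Digraph V) : Prop :=
  ∀ a b c d, IsInducedP4 G a b c d →
    (D.Adj a b ∧ D.Adj d c) ∨ (D.Adj b a ∧ D.Adj c d)

/-- `G` is an opposition graph. -/
def IsOppositionGraph (G : SimpleGraph V) : Prop :=
  ∃ D : Digraph V, IsOrientation G D ∧ IsAcyclic D ∧ IsOpposing G D

/-- `G` is a generalized opposition graph: the orientation need not be acyclic. -/
def IsGeneralizedOppositionGraph (G : SimpleGraph V) : Prop :=
  ∃ D : Digraph V, IsOrientation G D ∧ IsOpposing G D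

/-! ### The auxiliary graph -/

/-- `{x, y}` is an end-edge of an induced `P₄` of `G`. -/
def IsEndEdge (G : SimpleGraph V) (x y : V) : Prop :=
  ∃ c d, IsInducedP4 G x y c d ∨ IsInducedP4 G y x c d

/-- The auxiliary graph `𝒪(G)`: its vertices are the ordered pairs `(x, y)` such that `{x, y}`
is an end-edge of an induced `P₄` of `G`; the vertices `(x, y)` and `(u, v)` are adjacent if
`(x, y) = (v, u)` or `x y u v` or `u v x y` is an induced `P₄` of `G`. -/
def auxGraph (G : SimpleGraph V) : SimpleGraph {p : V × V // IsEndEdge G p.1 p.2} where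
  Adj p q :=
    p.1 = (q.1.2, q.1.1) ∨
    IsInducedP4 G p.1.1 p.1.2 q.1.1 q.1.2 ∨ IsInducedP4 G q.1.1 q.1.2 p.1.1 p.1.2
  symm := ⟨by
    rintro ⟨⟨x, y⟩, hp⟩ ⟨⟨u, v⟩, hq⟩ (h | h | h)
    · left
      simp only [Prod.mk.injEq] at h ⊢
      exact ⟨h.2.symm, h.1.symm⟩
    · exact Or.inr (Or.inr h)
    · exact Or.inr (Or.inl h)⟩
  loopless := ⟨by
    rintro ⟨⟨x, y⟩, ⟨c, d, hcd⟩⟩ (h | h | h)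
    · simp only [Prod.mk.injEq] at h
      rcases hcd with ⟨-, -, -, ha, -⟩ | ⟨-, -, -, ha, -⟩
      · exact ha.ne h.1
      · exact ha.ne h.2
    · exact h.1 rfl
    · exact h.1 rfl⟩

/-! ### The forbidden graphs -/

/-- The tree `T_k`: the path `0, 1, …, 2k + 3` together with a leaf `2k + 4` attached to the
third path vertex `2` and a leaf `2k + 5` attached to the third-last path vertex `2k + 1`. -/
def T (k : ℕ) : SimpleGraph (Fin (2 * k + 6)) :=
  SimpleGraph.fromRel fun i j =>
    (i.val + 1 = j.val ∧ j.val ≤ 2 * k + 3) ∨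
    (i.val = 2 ∧ j.val = 2 * k + 4) ∨
    (i.val = 2 * k + 1 ∧ j.val = 2 * k + 5)

/-- The graph `G₁`: the path `0 1 2 3 4 5` and the path `6 7 8`, with `6` adjacent to the two
middle vertices `2` and `3` (a triangle with a two-edge path attached to each of its vertices). -/
def G₁ : SimpleGraph (Fin 9) :=
  SimpleGraph.fromEdgeSet
    {s(0, 1), s(1, 2), s(2, 3), s(3, 4), s(4, 5), s(2, 6), s(3, 6), s(6, 7), s(7, 8)}

/-- The graph `G₂`: the path `0 1 2 3 4 5`, two non-adjacent vertices `6` and `7`, each adjacent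
to both middle vertices `2` and `3`, and a leaf `8` attached to `7`. -/
def G₂ : SimpleGraph (Fin 9) :=
  SimpleGraph.fromEdgeSet
    {s(0, 1), s(1, 2), s(2, 3), s(3, 4), s(4, 5), s(2, 6), s(3, 6), s(2, 7), s(3, 7), s(7, 8)}

end OppositionGraph

namespace OppositionGraph

universe u

variable {V : Type u}

/-! Chordality enters mostly through one principle, `IsLocInd.far`: a walk with no repetition or
chord two steps apart is an induced path. Gem-freeness then settles local configurations.

Opposing orientations are the same as proper 2-colourings of the auxiliary graph: the colour of (x,
y) records whether x → y. To make an opposing orientation acyclic, only its arcs on end-edges of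
induced P₄s matter. By `endArc.shortcut` a chord over two consecutive such arcs is again such an
arc, so a shortest closed walk of them would be locally induced, which is impossible. Hence these
arcs generate a partial order, and any linear extension of it orients G as required. The forbidden
graphs have contradictory constraints, and the property is hereditary.

The main point is to build an opposing orientation when the forbidden graphs are absent and G is
connected. If no vertex is the middle of an induced P₅, every end-edge can point from the end of its
P₄ to the inside. Otherwise let x and y be the neighbours of such a middle vertex on the P₅, and
layer G by distance to the clique of common neighbours of x and y. Adjacent vertices of a layer have
the same parents (`Layering.parent_adj`), so an induced path that goes up keeps going up. Edges
between layers are directed up, up, down, down with period 4. This opposes monotone P₄s at once, and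
opposes those turning at a lowest vertex exactly when that vertex lies on an even layer; an odd one
would produce some T_k or G₂ (`Layering.even_of_branching`). Edges inside a layer follow the P₄s
ending in them; conflicting demands would produce G₁ or G₂ (`Layering.flatArc_asymm`). -/

/-! ### Locally induced walks in chordal graphs -/

/-- Two distinct non-adjacent vertices. -/
def Far (G : SimpleGraph V) (u v : V) : Prop := u ≠ v ∧ ¬ G.Adj u v

theorem Far.symm {G : SimpleGraph V} {u v : V} (h : Far G u v) : Far G v u :=
  ⟨h.1.symm, fun h' => h.2 h'.symm⟩

theorem isIndContained_of_lt {W : Type*} [LinearOrder W] {H : SimpleGraph W} {G : SimpleGraph V}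
    (f : W → V) (h : ∀ i j, i < j → f i ≠ f j ∧ (H.Adj i j ↔ G.Adj (f i) (f j))) :
    H.IsIndContained G := by
  refine ⟨⟨⟨f, ?_⟩, ?_⟩⟩
  · intro i j hij
    rcases lt_trichotomy i j with hlt | heq | hlt
    · exact absurd hij (h i j hlt).1
    · exact heq
    · exact absurd hij.symm (h j i hlt).1
  · intro i j
    change G.Adj (f i) (f j) ↔ H.Adj i j
    rcases lt_trichotomy i j with hlt | heq | hlt
    · exact (h i j hlt).2.symm
    · subst heq; simp
    · rw [G.adj_comm, H.adj_comm]; exact (h j i hlt).2.symm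

/-- The walk `w 0, …, w n` has no repetition and no chord between vertices two steps apart. -/
def IsLocInd (G : SimpleGraph V) (w : ℕ → V) (n : ℕ) : Prop :=
  (∀ k, k < n → G.Adj (w k) (w (k + 1))) ∧ ∀ k, k + 2 ≤ n → Far G (w k) (w (k + 2))

/-- In a chordal graph a locally induced walk is an induced path. -/
theorem IsLocInd.far {G : SimpleGraph V} (hG : IsChordal G) {w : ℕ → V} {n : ℕ}
    (hw : IsLocInd G w n) {i j : ℕ} (hij : i + 2 ≤ j) (hj : j ≤ n) : Far G (w i) (w j) := by
  suffices H : ∀ m i, 2 ≤ m → i + m ≤ n → Far G (w i) (w (i + m)) by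
    have := H (j - i) i (by omega) (by omega)
    rwa [show i + (j - i) = j by omega] at this
  intro m
  induction m using Nat.strong_induction_on with
  | _ m ih =>
  intro i hm hn
  obtain rfl | hm3 : m = 2 ∨ 3 ≤ m := by omega
  · exact hw.2 i hn
  -- If the ends coincided, `w i` would be adjacent to `w (i + (m - 1))`, against the induction
  -- hypothesis for gap m - 1 ≥ 2.
  have hne : w i ≠ w (i + m) := by
    intro he
    refine (ih (m - 1) (by omega) i (by omega) (by omega)).2 ?_
    have := hw.1 (i + (m - 1)) (by omega)
    rw [show i + (m - 1) + 1 = i + m by omega, ← he] at this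
    exact this.symm
  refine ⟨hne, fun hadj => hG (m + 1) (by omega) ?_⟩
  -- All shorter gaps are chordless by induction, so an edge between the ends closes an induced
  -- cycle on m + 1 ≥ 4 vertices.
  refine isIndContained_of_lt (fun k => w (i + k.val)) fun a b hab => ?_
  have hab' : a.val < b.val := hab
  have hb : b.val ≤ m := by omega
  rw [SimpleGraph.cycleGraph_adj']
  have e1 : (b - a).val = b.val - a.val := Fin.sub_val_of_le hab.le
  have e2 : (a - b).val = m + 1 + a.val - b.val := by
    rw [Fin.sub_def]
    simp only
    rw [Nat.mod_eq_of_lt (by omega)]; omega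
  rw [e1, e2]
  by_cases h1 : b.val = a.val + 1
  · have := hw.1 (i + a.val) (by omega)
    rw [add_assoc, ← h1] at this
    exact ⟨this.ne, by simp only [this, iff_true]; omega⟩
  by_cases h2 : b.val - a.val = m
  · have ha0 : a.val = 0 := by omega
    have hbm : b.val = m := by omega
    simp only [ha0, hbm, add_zero]
    exact ⟨hne, by simp only [hadj, iff_true]; omega⟩
  · have := ih (b.val - a.val) (by omega) (i + a.val) (by omega) (by omega)
    rw [show i + a.val + (b.val - a.val) = i + b.val by omega] at this
    exact ⟨this.1, by simp only [this.2, iff_false]; omega⟩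

section Short

variable {G : SimpleGraph V} (hG : IsChordal G) {a b c d e f : V}
include hG

theorem far_path₄ (ab : G.Adj a b) (bc : G.Adj b c) (cd : G.Adj c d) (ac : Far G a c)
    (bd : Far G b d) : Far G a d := by
  let w : ℕ → V := fun k => match k with | 0 => a | 1 => b | 2 => c | _ => d
  have hw : IsLocInd G w 3 := by
    refine ⟨fun k hk => ?_, fun k hk => ?_⟩
    · interval_cases k <;> assumption
    · have : k < 2 := by omega
      interval_cases k <;> assumption
  exact hw.far hG (i := 0) (j := 3) (by omega) le_rfl

theorem far_path₅ (ab : G.Adj a b) (bc : G.Adj b c) (cd : G.Adj c d) (de : G.Adj d e)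
    (ac : Far G a c) (bd : Far G b d) (ce : Far G c e) : Far G a e := by
  let w : ℕ → V := fun k => match k with | 0 => a | 1 => b | 2 => c | 3 => d | _ => e
  have hw : IsLocInd G w 4 := by
    refine ⟨fun k hk => ?_, fun k hk => ?_⟩
    · interval_cases k <;> assumption
    · have : k < 3 := by omega
      interval_cases k <;> assumption
  exact hw.far hG (i := 0) (j := 4) (by omega) le_rfl

theorem far_path₆ (ab : G.Adj a b) (bc : G.Adj b c) (cd : G.Adj c d) (de : G.Adj d e)
    (ef : G.Adj e f) (ac : Far G a c) (bd : Far G b d) (ce : Far G c e) (df : Far G d f) :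
    Far G a f := by
  let w : ℕ → V := fun k => match k with | 0 => a | 1 => b | 2 => c | 3 => d | 4 => e | _ => f
  have hw : IsLocInd G w 5 := by
    refine ⟨fun k hk => ?_, fun k hk => ?_⟩
    · interval_cases k <;> assumption
    · have : k < 4 := by omega
      interval_cases k <;> assumption
  exact hw.far hG (i := 0) (j := 5) (by omega) le_rfl

/-- A chordal graph has no induced four-cycle. -/
theorem no_cycle₄ (ab : G.Adj a b) (bc : G.Adj b c) (cd : G.Adj c d) (da : G.Adj d a)
    (ac : Far G a c) (bd : Far G b d) : False :=
  (far_path₄ hG ab bc cd ac bd).2 da.symm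

omit hG in
theorem IsPtolemaic.no_gem (hG : IsPtolemaic G) {v : V} (ab : G.Adj a b) (bc : G.Adj b c)
    (cd : G.Adj c d) (ac : Far G a c) (bd : Far G b d) (va : G.Adj v a) (vb : G.Adj v b)
    (vc : G.Adj v c) (vd : G.Adj v d) : False := by
  have ad := far_path₄ hG.1 ab bc cd ac bd
  refine hG.2 (isIndContained_of_lt ![a, b, c, d, v] fun i j hij => ?_)
  fin_cases i <;> fin_cases j <;>
    first
    | exact absurd hij (by decide)
    | simp [gem, ab, bc, cd, ac.2, bd.2, ad.2, va.symm, vb.symm, vc.symm, vd.symm, ab.ne, bc.ne,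
        cd.ne, ac.1, bd.1, ad.1, va.ne', vb.ne', vc.ne', vd.ne']

end Short

/-! ### Recognizing the forbidden graphs -/

theorem IsLocInd.reverse {G : SimpleGraph V} {w : ℕ → V} {n : ℕ} (hw : IsLocInd G w n) :
    IsLocInd G (fun k => w (n - k)) n := by
  refine ⟨fun k hk => ?_, fun k hk => ?_⟩
  · have := (hw.1 (n - k - 1) (by omega)).symm
    rwa [show n - k - 1 + 1 = n - k by omega, show n - k - 1 = n - (k + 1) by omega] at this
  · have := (hw.2 (n - k - 2) (by omega)).symm
    rwa [show n - k - 2 + 2 = n - k by omega, show n - k - 2 = n - (k + 2) by omega] at this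

/-- Prepending `l` to the tail `w i, w (i + 1), …` gives another locally induced walk. -/
theorem IsLocInd.far_of_adj {G : SimpleGraph V} (hG : IsChordal G) {w : ℕ → V} {n : ℕ}
    (hw : IsLocInd G w n) {l : V} {i : ℕ} (hl : G.Adj l (w i)) (hf : Far G l (w (i + 1)))
    {j : ℕ} (hij : i < j) (hj : j ≤ n) : Far G l (w j) := by
  let u : ℕ → V := fun k => if k = 0 then l else w (i + k - 1)
  have hu : IsLocInd G u (n - i + 1) := by
    refine ⟨fun k hk => ?_, fun k hk => ?_⟩
    · obtain rfl | ⟨k, rfl⟩ : k = 0 ∨ ∃ k', k = k' + 1 := by cases k <;> simp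
      · simpa [u] using hl
      · simpa [u, add_assoc] using hw.1 (i + k) (by omega)
    · obtain rfl | ⟨k, rfl⟩ : k = 0 ∨ ∃ k', k = k' + 1 := by cases k <;> simp
      · simpa [u] using hf
      · have := hw.2 (i + k) (by omega)
        simpa [u, add_assoc] using this
  have := hu.far hG (i := 0) (j := j - i + 1) (by omega) (by omega)
  have e : u (j - i + 1) = w j := by simp [u, show i + (j - i) = j by omega]
  rwa [e] at this

theorem IsLocInd.far_of_adj' {G : SimpleGraph V} (hG : IsChordal G) {w : ℕ → V} {n : ℕ}
    (hw : IsLocInd G w n) {l : V} {i : ℕ} (hl : G.Adj l (w (i + 1))) (hf : Far G l (w i))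
    (hi : i + 1 ≤ n) {j : ℕ} (hij : j ≤ i) : Far G l (w j) := by
  have := hw.reverse.far_of_adj hG (l := l) (i := n - (i + 1)) (j := n - j)
    (by simpa [show n - (n - (i + 1)) = i + 1 by omega] using hl)
    (by simpa [show n - (n - (i + 1) + 1) = i by omega] using hf) (by omega) (by omega)
  simpa [show n - (n - j) = j by omega] using this

/-- Each leaf only has to miss the two path-neighbours of its attachment vertex; chordality excludes
every other edge. -/
theorem T_isIndContained {G : SimpleGraph V} (hG : IsChordal G) {w : ℕ → V} {k : ℕ}
    (hk : 1 ≤ k) (hw : IsLocInd G w (2 * k + 3)) {l m : V}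
    (hl : G.Adj l (w 2)) (hl1 : Far G l (w 1)) (hl3 : Far G l (w 3))
    (hm : G.Adj m (w (2 * k + 1))) (hm0 : Far G m (w (2 * k))) (hm2 : Far G m (w (2 * k + 2))) :
    (T k).IsIndContained G := by
  have hlf : ∀ j, j ≠ 2 → j ≤ 2 * k + 3 → Far G l (w j) := by
    intro j hj hjn
    rcases lt_or_gt_of_ne hj with h | h
    · exact hw.far_of_adj' hG hl hl1 (by omega) (by omega)
    · exact hw.far_of_adj hG hl hl3 h hjn
  have hmf : ∀ j, j ≠ 2 * k + 1 → j ≤ 2 * k + 3 → Far G m (w j) := by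
    intro j hj hjn
    rcases lt_or_gt_of_ne hj with h | h
    · exact hw.far_of_adj' hG hm hm0 (by omega) (by omega)
    · exact hw.far_of_adj hG hm hm2 h hjn
  have hlm : Far G l m := by
    -- Rerouting the path into `m` after `w (2k + 1)` makes `m` the end of a locally induced walk,
    -- which `l` can see only at `w 2`.
    let u : ℕ → V := fun j => if j = 2 * k + 2 then m else w j
    have hu : ∀ j, j ≤ 2 * k + 1 → u j = w j := fun j hj => if_neg (by omega)
    have hum : u (2 * k + 2) = m := if_pos rfl
    have hloc : IsLocInd G u (2 * k + 2) := by
      refine ⟨fun j hj => ?_, fun j hj => ?_⟩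
      · rw [hu j (by omega)]
        by_cases h : j = 2 * k + 1
        · subst h; rw [hum]; exact hm.symm
        · rw [hu _ (by omega)]; exact hw.1 j (by omega)
      · rw [hu j (by omega)]
        by_cases h : j = 2 * k
        · subst h; rw [hum]; exact hm0.symm
        · rw [hu _ (by omega)]; exact hw.2 j (by omega)
    rw [← hum]
    refine hloc.far_of_adj hG (i := 2) ?_ ?_ (by omega) le_rfl
    · rw [hu 2 (by omega)]; exact hl
    · rw [hu 3 (by omega)]; exact hl3
  let f : Fin (2 * k + 6) → V := fun i =>
    if i.val ≤ 2 * k + 3 then w i else if i.val = 2 * k + 4 then l else m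
  refine isIndContained_of_lt f fun i j hij => ?_
  have hij' : i.val < j.val := hij
  have hj := j.isLt
  have hadj : (T k).Adj i j ↔ (i.val + 1 = j.val ∧ j.val ≤ 2 * k + 3) ∨
      (i.val = 2 ∧ j.val = 2 * k + 4) ∨ (i.val = 2 * k + 1 ∧ j.val = 2 * k + 5) := by
    rw [T, SimpleGraph.fromRel_adj]
    constructor
    · rintro ⟨-, h | h⟩ <;> omega
    · exact fun h => ⟨hij.ne, Or.inl h⟩
  rw [hadj]
  by_cases h1 : j.val ≤ 2 * k + 3
  · have hfi : f i = w i := if_pos (by omega)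
    have hfj : f j = w j := if_pos h1
    rw [hfi, hfj]
    by_cases h2 : j.val = i.val + 1
    · have := hw.1 i.val (by omega)
      rw [← h2] at this
      exact ⟨this.ne, by simp only [this, iff_true]; omega⟩
    · have := hw.far hG (i := i.val) (j := j.val) (by omega) h1
      exact ⟨this.1, by simp only [this.2, iff_false]; omega⟩
  by_cases h2 : j.val = 2 * k + 4
  · have hfi : f i = w i := if_pos (by omega)
    have hfj : f j = l := by simp only [f]; rw [if_neg h1, if_pos h2]
    rw [hfi, hfj]
    by_cases h3 : i.val = 2
    · have : G.Adj (w i.val) l := by rw [h3]; exact hl.symm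
      exact ⟨this.ne, by simp only [this, iff_true]; omega⟩
    · have := (hlf i.val h3 (by omega)).symm
      exact ⟨this.1, by simp only [this.2, iff_false]; omega⟩
  have hfj : f j = m := by simp only [f]; rw [if_neg h1, if_neg h2]
  rw [hfj]
  by_cases h3 : i.val = 2 * k + 4
  · have hfi : f i = l := by simp only [f]; rw [if_neg (by omega), if_pos h3]
    rw [hfi]
    exact ⟨hlm.1, by simp only [hlm.2, iff_false]; omega⟩
  have hfi : f i = w i := if_pos (by omega)
  rw [hfi]
  by_cases h4 : i.val = 2 * k + 1
  · have : G.Adj (w i.val) m := by rw [h4]; exact hm.symm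
    exact ⟨this.ne, by simp only [this, iff_true]; omega⟩
  · have := (hmf i.val h4 (by omega)).symm
    exact ⟨this.1, by simp only [this.2, iff_false]; omega⟩

section Small

variable {G : SimpleGraph V}

/-- Two legs joined by a triangle edge form a locally induced path on six vertices, and the three
pairs of legs account for all required non-adjacencies. -/
theorem G₁_isIndContained (hG : IsChordal G) {a b c a₁ a₂ b₁ b₂ c₁ c₂ : V}
    (ab : G.Adj a b) (bc : G.Adj b c) (ac : G.Adj a c)
    (aa₁ : G.Adj a a₁) (a₁a₂ : G.Adj a₁ a₂) (a₁b : ¬ G.Adj a₁ b) (a₁c : ¬ G.Adj a₁ c)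
    (aa₂ : Far G a a₂)
    (bb₁ : G.Adj b b₁) (b₁b₂ : G.Adj b₁ b₂) (b₁a : ¬ G.Adj b₁ a) (b₁c : ¬ G.Adj b₁ c)
    (bb₂ : Far G b b₂)
    (cc₁ : G.Adj c c₁) (c₁c₂ : G.Adj c₁ c₂) (c₁a : ¬ G.Adj c₁ a) (c₁b : ¬ G.Adj c₁ b)
    (cc₂ : Far G c c₂) : G₁.IsIndContained G := by
  have fa₁b : Far G a₁ b := ⟨fun h => a₁c (h ▸ bc), a₁b⟩
  have fa₁c : Far G a₁ c := ⟨fun h => a₁b (h ▸ bc.symm), a₁c⟩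
  have fb₁a : Far G b₁ a := ⟨fun h => b₁c (h ▸ ac), b₁a⟩
  have fb₁c : Far G b₁ c := ⟨fun h => b₁a (h ▸ ac.symm), b₁c⟩
  have fc₁a : Far G c₁ a := ⟨fun h => c₁b (h ▸ ab), c₁a⟩
  have fc₁b : Far G c₁ b := ⟨fun h => c₁a (h ▸ ab.symm), c₁b⟩
  have legs : ∀ {u v p q r s : V}, G.Adj u v → G.Adj u p → G.Adj p q → G.Adj v r → G.Adj r s →
      Far G p v → Far G u q → Far G r u → Far G v s →
      Far G q v ∧ Far G p r ∧ Far G p s ∧ Far G q r ∧ Far G q s ∧ Far G s u := by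
    intro u v p q r s uv up pq vr rs pv uq ru vs
    exact ⟨far_path₄ hG pq.symm up.symm uv uq.symm pv,
      far_path₄ hG up.symm uv vr pv ru.symm,
      far_path₅ hG up.symm uv vr rs pv ru.symm vs,
      far_path₅ hG pq.symm up.symm uv vr uq.symm pv ru.symm,
      far_path₆ hG pq.symm up.symm uv vr rs uq.symm pv ru.symm vs,
      far_path₄ hG rs.symm vr.symm uv.symm vs.symm ru⟩
  obtain ⟨x1, x2, x3, x4, x5, x6⟩ := legs ab aa₁ a₁a₂ bb₁ b₁b₂ fa₁b aa₂ fb₁a bb₂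
  obtain ⟨y1, y2, y3, y4, y5, y6⟩ := legs bc bb₁ b₁b₂ cc₁ c₁c₂ fb₁c bb₂ fc₁b cc₂
  obtain ⟨z1, z2, z3, z4, z5, z6⟩ := legs ac aa₁ a₁a₂ cc₁ c₁c₂ fa₁c aa₂ fc₁a cc₂
  have nonadj : ∀ {p : Prop} {u v : V}, ¬ p → Far G u v → u ≠ v ∧ (p ↔ G.Adj u v) :=
    fun hp h => ⟨h.1, iff_of_false hp h.2⟩
  have adj : ∀ {p : Prop} {u v : V}, p → G.Adj u v → u ≠ v ∧ (p ↔ G.Adj u v) :=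
    fun hp h => ⟨h.ne, iff_of_true hp h⟩
  refine isIndContained_of_lt ![a₂, a₁, a, b, b₁, b₂, c, c₁, c₂] fun i j hij => ?_
  fin_cases i <;> fin_cases j <;>
    first
    | exact absurd hij (by decide)
    | exact nonadj (by simp [G₁]) (by first | assumption | (apply Far.symm; assumption))
    | exact adj (by simp [G₁]) (by first | assumption | (apply SimpleGraph.Adj.symm; assumption))

/-- The vertices `q₀, …, q₅` form a locally induced walk, `r` and `s` are common neighbours of
`q₂` and `q₃`, and `t` hangs on `s`. -/
theorem G₂_isIndContained (hG : IsPtolemaic G) {q₀ q₁ q₂ q₃ q₄ q₅ r s t : V}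
    (a01 : G.Adj q₀ q₁) (a12 : G.Adj q₁ q₂) (a23 : G.Adj q₂ q₃) (a34 : G.Adj q₃ q₄)
    (a45 : G.Adj q₄ q₅) (f02 : Far G q₀ q₂) (f13 : Far G q₁ q₃) (f24 : Far G q₂ q₄)
    (f35 : Far G q₃ q₅) (r2 : G.Adj q₂ r) (r3 : G.Adj q₃ r) (s2 : G.Adj q₂ s) (s3 : G.Adj q₃ s)
    (rs : Far G r s) (st : G.Adj s t) (t2 : Far G t q₂) : G₂.IsIndContained G := by
  have hC := hG.1
  -- An edge `pr` would give the 4-cycle `p r v s` if `p` sees `s`, and otherwise a gem on the path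
  -- `p r v s` with centre `u`.
  have side : ∀ {p u v r s : V}, G.Adj p u → G.Adj u v → Far G p v → G.Adj u r → G.Adj v r →
      G.Adj u s → G.Adj v s → Far G r s → Far G p r := by
    intro p u v r s pu uv pv ur vr us vs rs
    refine ⟨fun h => pv.2 (h ▸ vr.symm), fun pr => ?_⟩
    by_cases ps : G.Adj p s
    · exact no_cycle₄ hC pr vr.symm vs ps.symm pv rs
    · exact hG.no_gem pr vr.symm vs pv rs pu.symm ur uv us
  have f1r := side a12 a23 f13 r2 r3 s2 s3 rs
  have f1s := side a12 a23 f13 s2 s3 r2 r3 rs.symm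
  have f4r := side a34.symm a23.symm f24.symm r3 r2 s3 s2 rs
  have f4s := side a34.symm a23.symm f24.symm s3 s2 r3 r2 rs.symm
  have tr : Far G t r := far_path₄ hC st.symm s2.symm r2 t2 rs.symm
  have t3 : Far G t q₃ := by
    refine ⟨fun h => tr.2 (h ▸ r3), fun h => ?_⟩
    exact hG.no_gem r2.symm s2 st rs t2.symm r3 a23.symm s3 h.symm
  have f03 := far_path₄ hC a01 a12 a23 f02 f13
  have f14 := far_path₄ hC a12 a23 a34 f13 f24
  have f25 := far_path₄ hC a23 a34 a45 f24 f35
  have f04 := far_path₅ hC a01 a12 a23 a34 f02 f13 f24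
  have f15 := far_path₅ hC a12 a23 a34 a45 f13 f24 f35
  have f05 := far_path₆ hC a01 a12 a23 a34 a45 f02 f13 f24 f35
  have f0r := far_path₄ hC a01 a12 r2 f02 f1r
  have f0s := far_path₄ hC a01 a12 s2 f02 f1s
  have f5r := far_path₄ hC a45.symm a34.symm r3 f35.symm f4r
  have f5s := far_path₄ hC a45.symm a34.symm s3 f35.symm f4s
  have f1t := far_path₄ hC a12 s2 st f1s t2.symm
  have f0t := far_path₅ hC a01 a12 s2 st f02 f1s t2.symm
  have f4t := far_path₄ hC a34.symm s3 st f4s t3.symm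
  have f5t := far_path₅ hC a45.symm a34.symm s3 st f35.symm f4s t3.symm
  have nonadj : ∀ {p : Prop} {u v : V}, ¬ p → Far G u v → u ≠ v ∧ (p ↔ G.Adj u v) :=
    fun hp h => ⟨h.1, iff_of_false hp h.2⟩
  have adj : ∀ {p : Prop} {u v : V}, p → G.Adj u v → u ≠ v ∧ (p ↔ G.Adj u v) :=
    fun hp h => ⟨h.ne, iff_of_true hp h⟩
  refine isIndContained_of_lt ![q₀, q₁, q₂, q₃, q₄, q₅, r, s, t] fun i j hij => ?_
  fin_cases i <;> fin_cases j <;>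
    first
    | exact absurd hij (by decide)
    | exact nonadj (by simp [G₂]) (by first | assumption | (apply Far.symm; assumption))
    | exact adj (by simp [G₂]) (by assumption)

end Small

/-! ### Generalized opposition graphs and two-colourings -/

theorem IsInducedP4.symm {G : SimpleGraph V} {a b c d : V} (h : IsInducedP4 G a b c d) :
    IsInducedP4 G d c b a := by
  obtain ⟨ac, ad, bd, ab, bc, cd, nac, nad, nbd⟩ := h
  exact ⟨bd.symm, ad.symm, ac.symm, cd.symm, bc.symm, ab.symm, fun h => nbd h.symm,
    fun h => nad h.symm, fun h => nac h.symm⟩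

theorem isInducedP4_of_far {G : SimpleGraph V} (hG : IsChordal G) {a b c d : V}
    (ab : G.Adj a b) (bc : G.Adj b c) (cd : G.Adj c d) (ac : Far G a c) (bd : Far G b d) :
    IsInducedP4 G a b c d :=
  have ad := far_path₄ hG ab bc cd ac bd
  ⟨ac.1, ad.1, bd.1, ab, bc, cd, ac.2, ad.2, bd.2⟩

theorem IsInducedP4.isEndEdge {G : SimpleGraph V} {a b c d : V} (h : IsInducedP4 G a b c d) :
    IsEndEdge G a b := ⟨c, d, Or.inl h⟩

theorem IsEndEdge.symm {G : SimpleGraph V} {a b : V} (h : IsEndEdge G a b) : IsEndEdge G b a := by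
  obtain ⟨c, d, h⟩ := h
  exact ⟨c, d, h.symm⟩

theorem IsEndEdge.adj {G : SimpleGraph V} {a b : V} (h : IsEndEdge G a b) : G.Adj a b := by
  obtain ⟨c, d, h | h⟩ := h
  · exact h.2.2.2.1
  · exact h.2.2.2.1.symm

/-- An asymmetric relation orienting the end-edges of all induced paths on four vertices in
opposition extends to an opposing orientation. -/
theorem isGeneralizedOppositionGraph_of_rel {G : SimpleGraph V} (R : V → V → Prop)
    (hR : ∀ x y, G.Adj x y → R x y → ¬ R y x)
    (h : ∀ a b c d, IsInducedP4 G a b c d → (R a b ∧ R d c) ∨ (R b a ∧ R c d)) :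
    IsGeneralizedOppositionGraph G := by
  let D : Digraph V :=
    -- Edges on which `R` is silent in both directions are oriented by a fixed well-order.
    ⟨fun x y => G.Adj x y ∧ (R x y ∨ (¬ R y x ∧ WellOrderingRel x y))⟩
  refine ⟨D, ⟨fun x y hxy => hxy.1, fun x y hxy => ?_⟩, fun a b c d hP => ?_⟩
  · have h1 := hR x y hxy
    have h2 := hR y x hxy.symm
    have h3 : WellOrderingRel x y ∨ WellOrderingRel y x :=
      (trichotomous_of WellOrderingRel x y).imp_right fun h => h.resolve_left hxy.ne
    have h4 : ¬ (WellOrderingRel x y ∧ WellOrderingRel y x) :=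
      fun h => asymm_of WellOrderingRel h.1 h.2
    have h5 := hxy.symm
    change (((G.Adj x y ∧ _) ∧ ¬ (G.Adj y x ∧ _)) ∨ ((G.Adj y x ∧ _) ∧ ¬ (G.Adj x y ∧ _)))
    tauto
  · have ab : G.Adj a b := hP.2.2.2.1
    have cd : G.Adj c d := hP.2.2.2.2.2.1
    rcases h a b c d hP with ⟨h1, h2⟩ | ⟨h1, h2⟩
    · exact Or.inl ⟨⟨ab, Or.inl h1⟩, ⟨cd.symm, Or.inl h2⟩⟩
    · exact Or.inr ⟨⟨ab.symm, Or.inl h1⟩, ⟨cd, Or.inl h2⟩⟩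

theorem IsOppositionGraph.isGeneralized {G : SimpleGraph V} (h : IsOppositionGraph G) :
    IsGeneralizedOppositionGraph G := by
  obtain ⟨D, h1, -, h2⟩ := h
  exact ⟨D, h1, h2⟩

theorem IsOrientation.not_adj_symm {G : SimpleGraph V} {D : Digraph V} (h : IsOrientation G D)
    {x y : V} (hxy : D.Adj x y) : ¬ D.Adj y x := by
  have := h.2 x y (h.1 x y hxy)
  tauto

theorem IsOrientation.adj_iff {G : SimpleGraph V} {D : Digraph V} (h : IsOrientation G D)
    {x y : V} (hxy : G.Adj x y) : D.Adj x y ↔ ¬ D.Adj y x := by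
  have := h.2 x y hxy
  tauto

theorem IsOpposing.adj_iff {G : SimpleGraph V} {D : Digraph V} (hD : IsOrientation G D)
    (h : IsOpposing G D) {a b c d : V} (hP : IsInducedP4 G a b c d) :
    D.Adj a b ↔ D.Adj d c := by
  have h1 := hD.adj_iff hP.2.2.2.1
  have h2 := hD.adj_iff hP.2.2.2.2.2.1
  rcases h a b c d hP with h | h <;> tauto

theorem isGeneralizedOppositionGraph_iff_isBipartite {G : SimpleGraph V} :
    IsGeneralizedOppositionGraph G ↔ (auxGraph G).IsBipartite := by
  classical
  constructor
  · rintro ⟨D, hD, hO⟩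
    refine ⟨SimpleGraph.Coloring.mk (fun p => if D.Adj p.1.1 p.1.2 then 0 else 1) ?_⟩
    have key : ∀ {x y u v}, G.Adj x y → (D.Adj x y ↔ ¬ D.Adj u v) →
        (if D.Adj x y then (0 : Fin 2) else 1) ≠ if D.Adj u v then 0 else 1 := by
      intro x y u v _ h
      by_cases h' : D.Adj u v <;> simp [h, h']
    rintro ⟨⟨x, y⟩, hp⟩ ⟨⟨u, v⟩, hq⟩ (h | h | h)
    · simp only [Prod.mk.injEq] at h
      obtain ⟨rfl, rfl⟩ := h
      exact key hp.adj (hD.adj_iff hp.adj)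
    · exact key hp.adj (by rw [hO.adj_iff hD h, hD.adj_iff hq.adj.symm])
    · exact key hp.adj (by rw [hD.adj_iff hp.adj, hO.adj_iff hD h])
  · rintro ⟨C⟩
    have h01 : ∀ i j : Fin 2, i ≠ j → (i = 0 ↔ ¬ j = 0) := by decide
    have hsymm : ∀ x y (h : IsEndEdge G x y), C ⟨(x, y), h⟩ ≠ C ⟨(y, x), h.symm⟩ :=
      fun x y h => C.valid (Or.inl rfl)
    refine isGeneralizedOppositionGraph_of_rel
      (fun x y => ∃ h : IsEndEdge G x y, C ⟨(x, y), h⟩ = 0) ?_ ?_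
    · rintro x y - ⟨h, hC⟩ ⟨_, hC'⟩
      exact hsymm x y h (hC.trans hC'.symm)
    · intro a b c d hP
      have e1 := hP.isEndEdge
      have e2 := hP.symm.isEndEdge
      have h1 := h01 _ _ (hsymm a b e1)
      have h2 := h01 _ _ (hsymm d c e2)
      have h3 := h01 _ _ (C.valid (v := ⟨(a, b), e1⟩) (w := ⟨(c, d), e2.symm⟩) (Or.inr (Or.inl hP)))
      by_cases h : C ⟨(a, b), e1⟩ = 0
      · exact Or.inl ⟨⟨e1, h⟩, ⟨e2, by tauto⟩⟩
      · exact Or.inr ⟨⟨e1.symm, by tauto⟩, ⟨e2.symm, by tauto⟩⟩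

/-! ### Acyclic opposing orientations -/

/-- The arcs of `D` on end-edges of induced paths on four vertices. -/
def endArc (G : SimpleGraph V) (D : Digraph V) (x y : V) : Prop := IsEndEdge G x y ∧ D.Adj x y

/-- In a triangle `u v w` on an end-edge of the P₄ `u v c d`, the P₄ swings to another side: to `w v
c d` if `w` misses `c`, and to `u w c d` if `w` sees `c`, where a gem is the only obstacle. The far
edge `cd` stays, so the new end-edge inherits its direction. Each case gives either the arc `x → z`
or two opposite arcs on one edge. -/
theorem endArc.shortcut {G : SimpleGraph V} (hG : IsPtolemaic G) {D : Digraph V}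
    (hD : IsOrientation G D) (hO : IsOpposing G D) {x y z : V} (hxy : endArc G D x y)
    (hyz : endArc G D y z) (xz : G.Adj x z) : endArc G D x z := by
  have hC := hG.1
  obtain ⟨exy, xy⟩ := hxy
  obtain ⟨eyz, yz⟩ := hyz
  have axy := exy.adj
  have ayz := eyz.adj
  -- an induced path `u v c d` and a common neighbour `w` of `u` and `v`
  have swing : ∀ {u v w c d : V}, IsInducedP4 G u v c d → G.Adj u w → G.Adj v w →
      ¬ G.Adj w c → IsInducedP4 G w v c d := by
    intro u v w c d ⟨uc, ud, vd, uv, vc, cd, nuc, nud, nvd⟩ uw vw wc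
    exact isInducedP4_of_far hC vw.symm vc cd ⟨fun h => nuc (h ▸ uw), wc⟩ ⟨vd, nvd⟩
  have swing' : ∀ {u v w c d : V}, IsInducedP4 G u v c d → G.Adj u w → G.Adj v w →
      G.Adj w c → IsInducedP4 G u w c d := by
    intro u v w c d ⟨uc, ud, vd, uv, vc, cd, nuc, nud, nvd⟩ uw vw wc
    refine isInducedP4_of_far hC uw wc cd ⟨uc, nuc⟩ ⟨fun h => nud (h ▸ uw), fun h => ?_⟩
    exact hG.no_gem uv vc cd ⟨uc, nuc⟩ ⟨vd, nvd⟩ uw.symm vw.symm wc h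
  have asy : ∀ {u v}, D.Adj u v → D.Adj v u → False := fun h h' => hD.not_adj_symm h h'
  obtain ⟨c, d, h | h⟩ := exy
  · by_cases zc : G.Adj z c
    · have h' := swing' h xz ayz zc
      exact ⟨h'.isEndEdge, (hO.adj_iff hD h').2 ((hO.adj_iff hD h).1 xy)⟩
    · have h' := swing h xz ayz zc
      exact (asy yz ((hO.adj_iff hD h').2 ((hO.adj_iff hD h).1 xy))).elim
  · obtain ⟨c', d', k | k⟩ := eyz
    · by_cases zc : G.Adj z c
      · by_cases xc' : G.Adj x c'
        · have h' := swing' h ayz xz zc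
          exact (asy xy ((hO.adj_iff hD h).2 ((hO.adj_iff hD h').1 yz))).elim
        · have h' := swing k axy.symm xz.symm xc'
          exact ⟨h'.isEndEdge, (hO.adj_iff hD h').2 ((hO.adj_iff hD k).1 yz)⟩
      · have h' := swing h ayz xz zc
        refine ⟨h'.isEndEdge.symm, (hD.adj_iff xz).2 fun hzx => ?_⟩
        exact asy xy ((hO.adj_iff hD h).2 ((hO.adj_iff hD h').1 hzx))
    · by_cases xc : G.Adj x c'
      · have h' := swing' k xz.symm axy.symm xc
        refine ⟨h'.isEndEdge.symm, (hD.adj_iff xz).2 fun hzx => ?_⟩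
        exact asy yz ((hO.adj_iff hD k).2 ((hO.adj_iff hD h').1 hzx))
      · have h' := swing k xz.symm axy.symm xc
        exact (asy yz ((hO.adj_iff hD k).2 ((hO.adj_iff hD h').1 xy))).elim

theorem exists_walk_of_transGen {r : V → V → Prop} {x y : V} (h : Relation.TransGen r x y) :
    ∃ (n : ℕ) (w : ℕ → V), 1 ≤ n ∧ w 0 = x ∧ w n = y ∧ ∀ k < n, r (w k) (w (k + 1)) := by
  induction h with
  | single h =>
    rename_i b
    exact ⟨1, fun k => if k = 0 then x else b, le_rfl, rfl, rfl, fun k hk => by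
      obtain rfl : k = 0 := by omega
      simpa using h⟩
  | @tail b c _ h ih =>
    obtain ⟨n, w, hn, h0, h1, hw⟩ := ih
    refine ⟨n + 1, fun k => if k ≤ n then w k else c, by omega, by simpa using h0, by simp,
      fun k hk => ?_⟩
    by_cases hkn : k < n
    · simpa [hkn.le, Nat.succ_le_of_lt hkn] using hw k hkn
    · obtain rfl : k = n := by omega
      simpa [h1] using h

/-- A closed walk of minimal length would be locally induced, since `endArc.shortcut` removes any
chord over two steps; but the ends of a locally induced walk of length at least 2 are distinct. -/
theorem not_transGen_endArc {G : SimpleGraph V} (hG : IsPtolemaic G) {D : Digraph V}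
    (hD : IsOrientation G D) (hO : IsOpposing G D) (x : V) :
    ¬ Relation.TransGen (endArc G D) x x := by
  intro h
  obtain ⟨n, w, hn, h0, h1, hw⟩ := exists_walk_of_transGen h
  have hcl : w 0 = w n := h0.trans h1.symm
  clear h h0 h1
  induction n using Nat.strong_induction_on generalizing w with
  | _ n ih =>
  obtain rfl | hn2 : n = 1 ∨ 2 ≤ n := by omega
  · exact (hw 0 (by omega)).1.adj.ne hcl
  have hloc : IsLocInd G w n := by
    refine ⟨fun k hk => (hw k hk).1.adj, fun k hk => ⟨fun he => ?_, fun hadj => ?_⟩⟩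
    · have h1 := (hw k (by omega)).2
      have h2 := (hw (k + 1) (by omega)).2
      rw [show k + 1 + 1 = k + 2 by omega, ← he] at h2
      exact hD.not_adj_symm h1 h2
    · have hs := (hw k (by omega)).shortcut hG hD hO (hw (k + 1) (by omega)) hadj
      refine ih (n - 1) (by omega) (fun m => if m ≤ k then w m else w (m + 1)) (by omega) ?_ ?_
      · intro m hm
        rcases lt_trichotomy m k with h | h | h
        · simpa [h.le, Nat.succ_le_of_lt h] using hw m (by omega)
        · subst h; simpa using hs
        · simpa [show ¬ m ≤ k by omega, show ¬ m + 1 ≤ k by omega] using hw (m + 1) (by omega)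
      · simp only [Nat.zero_le, if_true]
        rw [if_neg (by omega), show n - 1 + 1 = n by omega]
        exact hcl
  exact (hloc.far hG.1 (i := 0) (j := n) (by omega) le_rfl).1 hcl

theorem IsGeneralizedOppositionGraph.isOppositionGraph {G : SimpleGraph V} (hG : IsPtolemaic G)
    (h : IsGeneralizedOppositionGraph G) : IsOppositionGraph G := by
  obtain ⟨D, hD, hO⟩ := h
  have hacyc := not_transGen_endArc hG hD hO
  have hpo : IsPartialOrder V (Relation.ReflTransGen (endArc G D)) :=
    { refl := fun _ => .refl
      trans := fun _ _ _ => .trans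
      antisymm := fun a b hab hba => by
        by_contra hne
        rcases Relation.reflTransGen_iff_eq_or_transGen.1 hab with h | h
        · exact hne h.symm
        · exact hacyc a (h.trans_left hba) }
  -- Orienting all edges along a linear extension is acyclic and keeps every arc that opposition
  -- constrains.
  obtain ⟨s, hs, hle⟩ := extend_partialOrder (Relation.ReflTransGen (endArc G D))
  have htr : ∀ a b c, s a b → s b c → s a c := fun a b c => hs.trans a b c
  have han : ∀ a b, s a b → s b a → a = b := fun a b => hs.antisymm a b
  have hto : ∀ a b, s a b ∨ s b a := fun a b => hs.total a b
  let E : Digraph V := ⟨fun x y => G.Adj x y ∧ s x y⟩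
  refine ⟨E, ⟨fun x y h => h.1, fun x y h => ?_⟩, fun x hx => ?_, fun a b c d hP => ?_⟩
  · have h1 := hto x y
    have h2 : ¬ (s x y ∧ s y x) := fun h' => h.ne (han x y h'.1 h'.2)
    have h3 := h.symm
    change (((G.Adj x y ∧ _) ∧ ¬ (G.Adj y x ∧ _)) ∨ ((G.Adj y x ∧ _) ∧ ¬ (G.Adj x y ∧ _)))
    tauto
  · have key : ∀ y, Relation.TransGen E.Adj x y → s x y ∧ x ≠ y := by
      intro y hy
      induction hy with
      | single h => exact ⟨h.2, h.1.ne⟩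
      | tail _ h ih =>
        refine ⟨htr _ _ _ ih.1 h.2, ?_⟩
        rintro rfl
        exact ih.2 (han _ _ ih.1 h.2)
    exact (key x hx).2 rfl
  · have ab : G.Adj a b := hP.2.2.2.1
    have cd : G.Adj c d := hP.2.2.2.2.2.1
    have hsub : ∀ {x y}, IsEndEdge G x y → D.Adj x y → s x y := fun h h' =>
      hle _ _ (.single ⟨h, h'⟩)
    have e1 := hP.isEndEdge
    have e2 := hP.symm.isEndEdge
    rcases hO a b c d hP with ⟨h1, h2⟩ | ⟨h1, h2⟩
    · exact Or.inl ⟨⟨ab, hsub e1 h1⟩, ⟨cd.symm, hsub e2 h2⟩⟩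
    · exact Or.inr ⟨⟨ab.symm, hsub e1.symm h1⟩, ⟨cd, hsub e2.symm h2⟩⟩

/-! ### The forbidden graphs are not generalized opposition graphs -/

theorem IsGeneralizedOppositionGraph.of_isIndContained {W : Type*} {H : SimpleGraph W}
    {G : SimpleGraph V} (h : IsGeneralizedOppositionGraph G) (hH : H.IsIndContained G) :
    IsGeneralizedOppositionGraph H := by
  obtain ⟨f⟩ := hH
  obtain ⟨D, hD, hO⟩ := h
  have hf : ∀ {x y}, G.Adj (f x) (f y) ↔ H.Adj x y := f.map_adj_iff
  refine ⟨⟨fun x y => D.Adj (f x) (f y)⟩, ⟨fun x y h => hf.1 (hD.1 _ _ h),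
    fun x y h => hD.2 _ _ (hf.2 h)⟩, fun a b c d hP => hO _ _ _ _ ?_⟩
  simpa [IsInducedP4, hf] using hP

/-- The leg at each triangle vertex forces it to be a source or a sink of the triangle, which is
impossible in an odd cycle. -/
theorem not_isGeneralizedOppositionGraph_G₁ : ¬ IsGeneralizedOppositionGraph G₁ := by
  rintro ⟨D, hD, hO⟩
  have h1 := hO.adj_iff hD (show IsInducedP4 G₁ 0 1 2 3 by simp [IsInducedP4, G₁])
  have h2 := hO.adj_iff hD (show IsInducedP4 G₁ 0 1 2 6 by simp [IsInducedP4, G₁])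
  have h3 := hO.adj_iff hD (show IsInducedP4 G₁ 5 4 3 2 by simp [IsInducedP4, G₁])
  have h4 := hO.adj_iff hD (show IsInducedP4 G₁ 5 4 3 6 by simp [IsInducedP4, G₁])
  have h5 := hO.adj_iff hD (show IsInducedP4 G₁ 8 7 6 2 by simp [IsInducedP4, G₁])
  have h6 := hO.adj_iff hD (show IsInducedP4 G₁ 8 7 6 3 by simp [IsInducedP4, G₁])
  have e1 := hD.adj_iff (show G₁.Adj 2 3 by simp [G₁])
  have e2 := hD.adj_iff (show G₁.Adj 2 6 by simp [G₁])
  have e3 := hD.adj_iff (show G₁.Adj 3 6 by simp [G₁])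
  tauto

/-- The six paths give the chain 3 → 2 iff 6 → 2 iff 8 → 7 iff 6 → 3 iff 2 → 3. -/
theorem not_isGeneralizedOppositionGraph_G₂ : ¬ IsGeneralizedOppositionGraph G₂ := by
  rintro ⟨D, hD, hO⟩
  have h1 := hO.adj_iff hD (show IsInducedP4 G₂ 0 1 2 3 by simp [IsInducedP4, G₂])
  have h2 := hO.adj_iff hD (show IsInducedP4 G₂ 0 1 2 6 by simp [IsInducedP4, G₂])
  have h3 := hO.adj_iff hD (show IsInducedP4 G₂ 5 4 3 2 by simp [IsInducedP4, G₂])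
  have h4 := hO.adj_iff hD (show IsInducedP4 G₂ 5 4 3 6 by simp [IsInducedP4, G₂])
  have h5 := hO.adj_iff hD (show IsInducedP4 G₂ 8 7 2 6 by simp [IsInducedP4, G₂])
  have h6 := hO.adj_iff hD (show IsInducedP4 G₂ 8 7 3 6 by simp [IsInducedP4, G₂])
  have e1 := hD.adj_iff (show G₂.Adj 2 3 by simp [G₂])
  tauto

theorem T_adj_iff {k : ℕ} {i j : Fin (2 * k + 6)} :
    (T k).Adj i j ↔ (i.val + 1 = j.val ∧ j.val ≤ 2 * k + 3) ∨
      (i.val = 2 ∧ j.val = 2 * k + 4) ∨ (i.val = 2 * k + 1 ∧ j.val = 2 * k + 5) ∨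
      (j.val + 1 = i.val ∧ i.val ≤ 2 * k + 3) ∨
      (j.val = 2 ∧ i.val = 2 * k + 4) ∨ (j.val = 2 * k + 1 ∧ i.val = 2 * k + 5) := by
  rw [T, SimpleGraph.fromRel_adj, Ne, Fin.ext_iff]
  omega

/-- Along the path, edges two apart have opposite directions. The left leaf makes the edges 23 and
34 agree, and this agreement moves two steps at a time to the right end, where the other leaf forces
the opposite. -/
theorem not_isGeneralizedOppositionGraph_T {k : ℕ} (hk : 1 ≤ k) :
    ¬ IsGeneralizedOppositionGraph (T k) := by
  rintro ⟨D, hD, hO⟩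
  let A : ℕ → ℕ → Prop := fun i j =>
    ∃ (hi : i < 2 * k + 6) (hj : j < 2 * k + 6), D.Adj ⟨i, hi⟩ ⟨j, hj⟩
  have hA : ∀ {i j} (hi : i < 2 * k + 6) (hj : j < 2 * k + 6), A i j ↔ D.Adj ⟨i, hi⟩ ⟨j, hj⟩ :=
    fun hi hj => ⟨fun ⟨_, _, h⟩ => h, fun h => ⟨hi, hj, h⟩⟩
  have hP : ∀ {a b c d : ℕ} (ha : a < 2 * k + 6) (hb : b < 2 * k + 6) (hc : c < 2 * k + 6)
      (hd : d < 2 * k + 6), IsInducedP4 (T k) ⟨a, ha⟩ ⟨b, hb⟩ ⟨c, hc⟩ ⟨d, hd⟩ →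
      (A a b ↔ A d c) := by
    intro a b c d ha hb hc hd h
    rw [hA ha hb, hA hd hc]
    exact hO.adj_iff hD h
  have hE : ∀ i, i + 1 ≤ 2 * k + 3 → (A (i + 1) i ↔ ¬ A i (i + 1)) := by
    intro i hi
    rw [hA (by omega) (by omega), hA (by omega) (by omega)]
    exact hD.adj_iff (T_adj_iff.2 (by simp only [true_and]; omega))
  have path : ∀ i, i + 3 ≤ 2 * k + 3 → (A i (i + 1) ↔ ¬ A (i + 2) (i + 3)) := by
    intro i hi
    rw [← hE (i + 2) (by omega)]
    refine hP (by omega) (by omega) (by omega) (by omega) ?_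
    simp only [IsInducedP4, T_adj_iff, ne_eq, Fin.mk.injEq, true_and]
    omega
  have left : A 0 1 ↔ ¬ A 3 4 := by
    rw [← hE 3 (by omega)]
    -- The leaf edge at 2 ends both the P₄ containing 01 and the P₄ containing 34.
    trans A (2 * k + 4) 2
    all_goals
      refine hP (by omega) (by omega) (by omega) (by omega) ?_
      simp only [IsInducedP4, T_adj_iff, ne_eq, Fin.mk.injEq, true_and, true_or, or_true]
      omega
  have right : A (2 * k - 1) (2 * k) ↔ ¬ A (2 * k + 2) (2 * k + 3) := by
    rw [← hE (2 * k + 2) (by omega)]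
    trans A (2 * k + 5) (2 * k + 1)
    all_goals
      refine hP (by omega) (by omega) (by omega) (by omega) ?_
      simp only [IsInducedP4, T_adj_iff, ne_eq, Fin.mk.injEq, true_and, true_or, or_true]
      omega
  clear_value A
  have alt : ∀ j, j + 1 ≤ k → (A (2 * j + 2) (2 * j + 3) ↔ A (2 * j + 3) (2 * j + 4)) := by
    intro j
    induction j with
    | zero => intro _; have := path 0 (by omega); exact not_iff_not.1 (this.symm.trans left)
    | succ j ih =>
      intro hj
      have h1 := path (2 * j + 2) (by omega)
      have h2 := path (2 * j + 3) (by omega)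
      exact not_iff_not.1 (h1.symm.trans ((ih (by omega)).trans h2))
  obtain ⟨j, rfl⟩ : ∃ j, k = j + 1 := ⟨k - 1, by omega⟩
  have a1 : A (2 * j + 2) (2 * j + 3) ↔ A (2 * j + 3) (2 * j + 4) := alt j (by omega)
  have a2 : A (2 * j + 1) (2 * j + 2) ↔ ¬ A (2 * j + 3) (2 * j + 4) := path (2 * j + 1) (by omega)
  have a3 : A (2 * j + 2) (2 * j + 3) ↔ ¬ A (2 * j + 4) (2 * j + 5) := path (2 * j + 2) (by omega)
  have a4 : A (2 * j + 1) (2 * j + 2) ↔ ¬ A (2 * j + 4) (2 * j + 5) := right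
  tauto

/-! ### Distance layers around the common neighbourhood of two non-adjacent vertices -/

/-- The function `ℓ` is the distance to the common neighbourhood of the non-adjacent vertices
`x` and `y`, each of which has a neighbour `x'`, `y'` away from that common neighbourhood. -/
structure Layering (G : SimpleGraph V) (x y x' y' : V) (ℓ : V → ℕ) : Prop where
  far : Far G x y
  adj_left : G.Adj x x'
  adj_right : G.Adj y y'
  zero_iff : ∀ v, ℓ v = 0 ↔ G.Adj x v ∧ G.Adj y v
  far_left : ∀ q, ℓ q = 0 → Far G q x'
  far_right : ∀ q, ℓ q = 0 → Far G q y'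
  le : ∀ u v, G.Adj u v → ℓ v ≤ ℓ u + 1
  parent : ∀ v n, ℓ v = n + 1 → ∃ u, G.Adj u v ∧ ℓ u = n

namespace Layering

variable {G : SimpleGraph V} {x y x' y' : V} {ℓ : V → ℕ}

theorem symm (L : Layering G x y x' y' ℓ) : Layering G y x y' x' ℓ :=
  ⟨L.far.symm, L.adj_right, L.adj_left, fun v => (L.zero_iff v).trans and_comm, L.far_right,
    L.far_left, L.le, L.parent⟩

theorem far_of_level (L : Layering G x y x' y' ℓ) {u v : V} (h : ℓ u + 2 ≤ ℓ v) : Far G u v :=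
  ⟨fun e => by rw [e] at h; omega, fun e => by have := L.le _ _ e; omega⟩

theorem far_of_not_adj {u v : V} (h : ℓ u ≠ ℓ v) (h' : ¬ G.Adj u v) : Far G u v :=
  ⟨fun e => h (e ▸ rfl), h'⟩

theorem level_left (L : Layering G x y x' y' ℓ) {q : V} (hq : ℓ q = 0) : ℓ x = 1 := by
  have h1 := L.le q x ((L.zero_iff q).1 hq).1.symm
  have h2 : ℓ x ≠ 0 := fun h => G.loopless.irrefl x ((L.zero_iff x).1 h).1
  omega

theorem clique (hG : IsChordal G) (L : Layering G x y x' y' ℓ) {p q : V} (hp : ℓ p = 0)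
    (hq : ℓ q = 0) : p = q ∨ G.Adj p q := by
  by_contra h
  push Not at h
  have h1 := (L.zero_iff p).1 hp
  have h2 := (L.zero_iff q).1 hq
  exact no_cycle₄ hG h1.1 h1.2.symm h2.2 h2.1.symm L.far h

/-- Outside the common neighbourhood, one of `x` and `y` is not adjacent to a given vertex. -/
theorem far_or_far (L : Layering G x y x' y' ℓ) {u : V} (hu : ℓ u ≠ 0) :
    Far G x u ∨ Far G y u := by
  by_contra h
  have h1 : ¬ (G.Adj x u ∧ G.Adj y u) := fun h => hu ((L.zero_iff u).2 h)
  have h2 := L.far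
  simp only [Far, not_or, not_and, not_not] at h h2 h1
  by_cases hx : x = u
  · subst hx; exact h2.2 (h.2 h2.1.symm).symm
  by_cases hy : y = u
  · subst hy; exact h2.2 (h.1 hx)
  exact h1 (h.1 hx) (h.2 hy)

theorem exists_descent (L : Layering G x y x' y' ℓ) (n : ℕ) : ∀ v, ℓ v = n →
    ∃ s : ℕ → V, s n = v ∧ (∀ k ≤ n, ℓ (s k) = k) ∧ ∀ k < n, G.Adj (s k) (s (k + 1)) := by
  induction n with
  | zero => exact fun v hv => ⟨fun _ => v, rfl, fun k hk => by simp [hv]; omega, by simp⟩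
  | succ n ih =>
    intro v hv
    obtain ⟨u, huv, hu⟩ := L.parent v n hv
    obtain ⟨s, h0, h1, h2⟩ := ih u hu
    refine ⟨fun k => if k ≤ n then s k else v, by simp, fun k hk => ?_, fun k hk => ?_⟩
    · by_cases h : k ≤ n
      · simpa [h] using h1 k h
      · simp only [h, if_false]; omega
    · by_cases h : k < n
      · simpa [h.le, Nat.succ_le_of_lt h] using h2 k h
      · obtain rfl : k = n := by omega
        simpa [h0] using huv

/-- Descending from two non-adjacent parents to layer 0 gives a locally induced walk through `u`.
Its ends would be distinct and non-adjacent, yet layer 0 is a clique. -/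
theorem parents_adj_of_eq (hG : IsChordal G) (L : Layering G x y x' y' ℓ) {p p' u : V}
    (hp : ℓ p + 1 = ℓ u) (hp' : ℓ p' + 1 = ℓ u) (pu : G.Adj p u) (pu' : G.Adj p' u) :
    p = p' ∨ G.Adj p p' := by
  by_contra hne
  have hfar : Far G p p' := by simpa [Far, not_or] using hne
  obtain ⟨s, s0, s1, s2⟩ := L.exists_descent (ℓ p) p rfl
  obtain ⟨t, t0, t1, t2⟩ := L.exists_descent (ℓ p) p' (by omega)
  generalize ℓ p = j at *
  let w : ℕ → V := fun k => if k ≤ j then s k else if k = j + 1 then u else t (2 * j + 2 - k)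
  have ws : ∀ k, k ≤ j → w k = s k := fun k hk => if_pos hk
  have wu : w (j + 1) = u := by simp [w]
  have wt : ∀ k, j + 2 ≤ k → w k = t (2 * j + 2 - k) := fun k hk => by
    simp only [w]; rw [if_neg (by omega), if_neg (by omega)]
  have wj2 : w (j + 2) = p' := by rw [wt _ le_rfl, show 2 * j + 2 - (j + 2) = j by omega, t0]
  have hloc : IsLocInd G w (2 * j + 2) := by
    refine ⟨fun k hk => ?_, fun k hk => ?_⟩
    · rcases lt_trichotomy k j with h | h | h
      · rw [ws k h.le, ws _ h]; exact s2 k h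
      · subst h; rw [ws k le_rfl, wu, s0]; exact pu
      · by_cases h' : k = j + 1
        · subst h'; rw [wu, wj2]; exact pu'.symm
        · rw [wt k (by omega), wt _ (by omega)]
          have := (t2 (2 * j + 2 - (k + 1)) (by omega)).symm
          rwa [show 2 * j + 2 - (k + 1) + 1 = 2 * j + 2 - k by omega] at this
    · rcases lt_trichotomy k j with h | h | h
      · by_cases h' : k + 1 = j
        · rw [ws k h.le, show k + 2 = j + 1 by omega, wu]
          exact L.far_of_level (by rw [s1 k h.le]; omega)
        · rw [ws k h.le, ws _ (by omega)]
          exact L.far_of_level (by rw [s1 k h.le, s1 _ (by omega)])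
      · subst h; rw [ws k le_rfl, wj2, s0]; exact hfar
      · by_cases h' : k = j + 1
        · subst h'; rw [wu, wt _ (by omega)]
          exact (L.far_of_level (by rw [t1 _ (by omega)]; omega)).symm
        · rw [wt k (by omega), wt _ (by omega)]
          exact (L.far_of_level (by rw [t1 _ (by omega), t1 _ (by omega)]; omega)).symm
  have := hloc.far hG (i := 0) (j := 2 * j + 2) (by omega) le_rfl
  rw [ws 0 (by omega), wt _ (by omega)] at this
  rcases L.clique hG (s1 0 (by omega)) (t1 (2 * j + 2 - (2 * j + 2)) (by omega) |>.trans (by omega))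
    with h | h
  · exact this.1 h
  · exact this.2 h

/-- Without a cross edge, the walk of `parents_adj_of_eq` can be run over the two summits `u` and
`v`. -/
theorem parents_adj_of_adj (hG : IsChordal G) (L : Layering G x y x' y' ℓ) {p p' u v : V}
    (hp : ℓ p + 1 = ℓ u) (hp' : ℓ p' + 1 = ℓ v) (huv : ℓ u = ℓ v) (uv : G.Adj u v)
    (pu : G.Adj p u) (pv : G.Adj p' v) : p = p' ∨ G.Adj p p' := by
  by_cases pv' : G.Adj p v
  · exact L.parents_adj_of_eq hG (huv ▸ hp) hp' pv' pv
  by_cases pu' : G.Adj p' u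
  · exact L.parents_adj_of_eq hG hp (huv ▸ hp') pu pu'
  have fpv : Far G p v := far_of_not_adj (ℓ := ℓ) (by omega) pv'
  have fpu : Far G p' u := far_of_not_adj (ℓ := ℓ) (by omega) pu'
  by_contra hne
  obtain ⟨s, s0, s1, s2⟩ := L.exists_descent (ℓ p) p rfl
  obtain ⟨t, t0, t1, t2⟩ := L.exists_descent (ℓ p) p' (by omega)
  generalize ℓ p = j at *
  let w : ℕ → V := fun k => if k ≤ j then s k else if k = j + 1 then u else
    if k = j + 2 then v else t (2 * j + 3 - k)
  have ws : ∀ k, k ≤ j → w k = s k := fun k hk => if_pos hk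
  have wu : w (j + 1) = u := by simp [w]
  have wv : w (j + 2) = v := by simp [w]
  have wt : ∀ k, j + 3 ≤ k → w k = t (2 * j + 3 - k) := fun k hk => by
    simp only [w]; rw [if_neg (by omega), if_neg (by omega), if_neg (by omega)]
  have wj3 : w (j + 3) = p' := by rw [wt _ le_rfl, show 2 * j + 3 - (j + 3) = j by omega, t0]
  have hloc : IsLocInd G w (2 * j + 3) := by
    refine ⟨fun k hk => ?_, fun k hk => ?_⟩
    · rcases lt_trichotomy k j with h | h | h
      · rw [ws k h.le, ws _ h]; exact s2 k h
      · subst h; rw [ws k le_rfl, wu, s0]; exact pu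
      · by_cases h' : k = j + 1
        · subst h'; rw [wu, wv]; exact uv
        by_cases h'' : k = j + 2
        · subst h''; rw [wv, wj3]; exact pv.symm
        · rw [wt k (by omega), wt _ (by omega)]
          have := (t2 (2 * j + 3 - (k + 1)) (by omega)).symm
          rwa [show 2 * j + 3 - (k + 1) + 1 = 2 * j + 3 - k by omega] at this
    · rcases lt_trichotomy k j with h | h | h
      · by_cases h' : k + 1 = j
        · rw [ws k h.le, show k + 2 = j + 1 by omega, wu]
          exact L.far_of_level (by rw [s1 k h.le]; omega)
        · rw [ws k h.le, ws _ (by omega)]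
          exact L.far_of_level (by rw [s1 k h.le, s1 _ (by omega)])
      · subst h; rw [ws k le_rfl, wv, s0]; exact fpv
      · by_cases h' : k = j + 1
        · subst h'; rw [wu, wj3]; exact fpu.symm
        by_cases h'' : k = j + 2
        · subst h''; rw [wv, wt _ (by omega)]
          exact (L.far_of_level (by rw [t1 _ (by omega)]; omega)).symm
        · rw [wt k (by omega), wt _ (by omega)]
          exact (L.far_of_level (by rw [t1 _ (by omega), t1 _ (by omega)]; omega)).symm
  have := hloc.far hG (i := 0) (j := 2 * j + 3) (by omega) le_rfl
  rw [ws 0 (by omega), wt _ (by omega)] at this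
  rcases L.clique hG (s1 0 (by omega)) (t1 (2 * j + 3 - (2 * j + 3)) (by omega) |>.trans (by omega))
    with h | h
  · exact this.1 h
  · exact this.2 h

/-- Adjacent vertices of the same layer have the same neighbours in the previous layer. -/
theorem parent_adj (hG : IsPtolemaic G) (L : Layering G x y x' y' ℓ) (n : ℕ) :
    ∀ {p u v : V}, ℓ p = n → ℓ p + 1 = ℓ u → ℓ u = ℓ v → G.Adj u v → G.Adj p u → G.Adj p v := by
  have hC := hG.1
  induction n with
  | zero =>
    intro p u v hn hp huv uv pu
    by_contra pv
    obtain ⟨p', pv', hp'⟩ := L.parent v (ℓ p) (by omega)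
    have hpp : G.Adj p p' := (L.clique hC hn (hp'.trans hn)).resolve_left
      (by rintro rfl; exact pv pv')
    have fpv : Far G p v := far_of_not_adj (ℓ := ℓ) (by omega) pv
    have pu' : G.Adj p' u := by
      by_contra h
      exact no_cycle₄ hC pu uv pv'.symm hpp.symm fpv
        (far_of_not_adj (ℓ := ℓ) (by omega) fun h' => h h'.symm)
    -- Below layer 0 there are no parents; their role is played by whichever of `x`, `y` is far from
    -- `u`, being adjacent to all of layer 0.
    have key : ∀ w, (∀ q, ℓ q = 0 → G.Adj w q) → Far G w u → False := by
      intro w hw wu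
      have wp := hw p hn
      have wp' := hw p' (by omega)
      have wv : w ≠ v := by rintro rfl; exact pv wp.symm
      by_cases h : G.Adj w v
      · exact no_cycle₄ hC wp pu uv h.symm wu fpv
      · exact hG.no_gem wp pu uv wu fpv wp'.symm hpp.symm pu' pv'
    rcases L.far_or_far (u := u) (by omega) with h | h
    · exact key x (fun q hq => ((L.zero_iff q).1 hq).1) h
    · exact key y (fun q hq => ((L.zero_iff q).1 hq).2) h
  | succ n ih =>
    intro p u v hn hp huv uv pu
    by_contra pv
    obtain ⟨p', pv', hp'⟩ := L.parent v (ℓ p) (by omega)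
    have hpp : G.Adj p p' := (L.parents_adj_of_adj hC hp (by omega) huv uv pu pv').resolve_left
      (by rintro rfl; exact pv pv')
    have fpv : Far G p v := far_of_not_adj (ℓ := ℓ) (by omega) pv
    have pu' : G.Adj p' u := by
      by_contra h
      exact no_cycle₄ hC pu uv pv'.symm hpp.symm fpv
        (far_of_not_adj (ℓ := ℓ) (by omega) fun h' => h h'.symm)
    obtain ⟨g, gp', hg⟩ := L.parent p' n (by omega)
    have gp : G.Adj g p := ih hg (by omega) hp' hpp.symm gp'
    -- The path `g p u v` is dominated by `p'`.
    exact hG.no_gem gp pu uv (L.far_of_level (by omega)) fpv gp'.symm hpp.symm pu' pv'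

/-- An induced path that goes up a layer keeps going up. -/
theorem level_up (hG : IsPtolemaic G) (L : Layering G x y x' y' ℓ) {u v w : V}
    (uv : G.Adj u v) (vw : G.Adj v w) (uw : Far G u w) (h : ℓ v = ℓ u + 1) : ℓ w = ℓ v + 1 := by
  have h1 := L.le _ _ vw
  have h2 := L.le _ _ vw.symm
  by_contra hne
  rcases (by omega : ℓ w = ℓ v ∨ ℓ w + 1 = ℓ v) with h' | h'
  · exact uw.2 (L.parent_adj hG _ rfl h.symm h'.symm vw uv)
  · rcases L.parents_adj_of_eq hG.1 h.symm h' uv vw.symm with h | h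
    · exact uw.1 h
    · exact uw.2 h

/-- A parent of one vertex of the path is a parent of all four, hence the centre of a gem; layer 0
is a clique. -/
theorem no_flat_path (hG : IsPtolemaic G) (L : Layering G x y x' y' ℓ) {a b c d : V}
    (ab : G.Adj a b) (bc : G.Adj b c) (cd : G.Adj c d) (ac : Far G a c) (bd : Far G b d)
    (hab : ℓ a = ℓ b) (hbc : ℓ b = ℓ c) (hcd : ℓ c = ℓ d) : False := by
  rcases Nat.eq_zero_or_pos (ℓ a) with h | h
  · rcases L.clique hG.1 h (q := c) (by omega) with h | h
    · exact ac.1 h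
    · exact ac.2 h
  · obtain ⟨p, pa, hp⟩ := L.parent a (ℓ a - 1) (by omega)
    have pb := L.parent_adj hG _ rfl (by omega) hab ab pa
    have pc := L.parent_adj hG _ rfl (by omega) hbc bc pb
    have pd := L.parent_adj hG _ rfl (by omega) hcd cd pc
    exact hG.no_gem ab bc cd ac bd pa pb pc pd

/-- Otherwise `x` and `y` are attached to opposite ends of the edge `cd`, and a common parent is the
centre of a gem on the resulting path. -/
theorem far_both_or (hG : IsPtolemaic G) (L : Layering G x y x' y' ℓ) {c d : V} (hc : ℓ c = 1)
    (hd : ℓ d = 1) (cd : c = d ∨ G.Adj c d) :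
    (Far G x c ∧ Far G x d) ∨ (Far G y c ∧ Far G y d) := by
  have h1 := L.far_or_far (u := c) (by omega)
  have h2 := L.far_or_far (u := d) (by omega)
  rcases cd with rfl | cd
  · tauto
  obtain ⟨p, pc, hp⟩ := L.parent c 0 hc
  have pd := L.parent_adj hG _ rfl (by omega) (hc.trans hd.symm) cd pc
  have key : ∀ {x y c d : V}, Far G x d → Far G y c → G.Adj c d → G.Adj p x → G.Adj p y →
      G.Adj p c → G.Adj p d → Far G x c ∨ Far G y d := by
    intro x y c d xd yc cd px py pc pd
    by_contra h
    rw [not_or] at h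
    have xc : G.Adj x c := by
      by_contra h'
      exact h.1 ⟨by rintro rfl; exact xd.2 cd, h'⟩
    have yd : G.Adj y d := by
      by_contra h'
      exact h.2 ⟨by rintro rfl; exact yc.2 cd.symm, h'⟩
    exact hG.no_gem xc cd yd.symm xd yc.symm px pc pd py
  have px := ((L.zero_iff p).1 hp).1.symm
  have py := ((L.zero_iff p).1 hp).2.symm
  by_cases a1 : Far G x c <;> by_cases a2 : Far G x d <;> by_cases a3 : Far G y c <;>
    by_cases a4 : Far G y d <;> try tauto
  · have := key a1 a4 cd.symm px py pd pc
    tauto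
  · have := key a2 a3 cd px py pc pd
    tauto

/-- Every clique of at most two vertices of a layer other than the first one has a common
neighbour in the previous layer from which an induced path of length two leads away. -/
theorem exists_leg (hG : IsPtolemaic G) (L : Layering G x y x' y' ℓ) {c d : V} (hc : ℓ c ≠ 0)
    (hcd : ℓ c = ℓ d) (cd : c = d ∨ G.Adj c d) :
    ∃ p p₁ p₂, ℓ p + 1 = ℓ c ∧ G.Adj p c ∧ G.Adj p d ∧ G.Adj p p₁ ∧ Far G p₁ c ∧ Far G p₁ d ∧
      G.Adj p₁ p₂ ∧ Far G p p₂ := by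
  obtain ⟨p, pc, hp⟩ := L.parent c (ℓ c - 1) (by omega)
  have pd : G.Adj p d := by
    rcases cd with rfl | cd
    · exact pc
    · exact L.parent_adj hG _ rfl (by omega) hcd cd pc
  refine ⟨p, ?_⟩
  -- From layer 0 the leg leaves through `x, x'` or `y, y'`; from higher layers it descends to a
  -- grandparent of `c` and one vertex beyond.
  rcases (by omega : ℓ c = 1 ∨ 2 ≤ ℓ c) with h | h
  · have hp0 : ℓ p = 0 := by omega
    have hz := (L.zero_iff p).1 hp0
    rcases L.far_both_or hG h (by omega) cd with h | h
    · exact ⟨x, x', by omega, pc, pd, hz.1.symm, h.1, h.2, L.adj_left, L.far_left p hp0⟩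
    · exact ⟨y, y', by omega, pc, pd, hz.2.symm, h.1, h.2, L.adj_right, L.far_right p hp0⟩
  · obtain ⟨q, qp, hq⟩ := L.parent p (ℓ p - 1) (by omega)
    refine ⟨q, ?_⟩
    have main : ∃ r, G.Adj q r ∧ Far G p r := by
      rcases (by omega : ℓ q = 0 ∨ 1 ≤ ℓ q) with h | h
      · have hz := (L.zero_iff q).1 h
        rcases L.far_or_far (u := p) (by omega) with h' | h'
        · exact ⟨x, hz.1.symm, h'.symm⟩
        · exact ⟨y, hz.2.symm, h'.symm⟩
      · obtain ⟨r, rq, hr⟩ := L.parent q (ℓ q - 1) (by omega)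
        exact ⟨r, rq.symm, (L.far_of_level (by omega)).symm⟩
    obtain ⟨r, qr, pr⟩ := main
    exact ⟨r, by omega, pc, pd, qp.symm, L.far_of_level (by omega), L.far_of_level (by omega),
      qr, pr⟩

end Layering

/-! ### The orientation by layers -/

/-- Three pairwise non-adjacent neighbours `x`, `y`, `z` of `h`, where `x` and `y` have
neighbours `x'` and `y'` that are not adjacent to `h`. -/
def IsHub (G : SimpleGraph V) (h x y z x' y' : V) : Prop :=
  G.Adj h x ∧ G.Adj h y ∧ G.Adj h z ∧ Far G x y ∧ Far G x z ∧ Far G y z ∧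
    G.Adj x x' ∧ G.Adj y y' ∧ Far G h x' ∧ Far G h y'

namespace Layering

variable {G : SimpleGraph V} {x y x' y' : V} {ℓ : V → ℕ}

/-- The path is `w', w, s 0, …, s n, b, a`, with leaves `l` at `s 0` and `d` at `s n`. For n = 2m +
1 it ends at index 2(m + 1) + 3, so the tree is T_{m + 1}; even n would not fit. -/
theorem exists_T (hG : IsPtolemaic G) (L : Layering G x y x' y' ℓ) {s : ℕ → V} {n : ℕ}
    (hn : Odd n) (hs : ∀ k ≤ n, ℓ (s k) = k) (hadj : ∀ k < n, G.Adj (s k) (s (k + 1)))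
    {w w' l a b d : V} (sw : G.Adj (s 0) w) (ww' : G.Adj w w') (sw' : Far G (s 0) w')
    (ws : Far G w (s 1)) (sl : G.Adj (s 0) l) (lw : Far G l w) (ls : Far G l (s 1))
    (ab : G.Adj a b) (bc : G.Adj b (s n)) (cd : G.Adj (s n) d) (ha : ℓ a = n + 2)
    (hb : ℓ b = n + 1) (hd : ℓ d = n + 1) (bd : Far G b d) :
    ∃ k, 1 ≤ k ∧ (T k).IsIndContained G := by
  obtain ⟨m, rfl⟩ := hn
  let f : ℕ → V := fun j => if j = 0 then w' else if j = 1 then w else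
    if j ≤ 2 * m + 3 then s (j - 2) else if j = 2 * m + 4 then b else a
  have f0 : f 0 = w' := rfl
  have f1 : f 1 = w := rfl
  have fs : ∀ j, j ≤ 2 * m + 1 → f (j + 2) = s j := fun j hj => by
    simp [f, show j + 2 ≤ 2 * m + 3 by omega]
  have f4 : f (2 * m + 4) = b := by simp [f]
  have f5 : f (2 * m + 5) = a := by simp [f]
  have hloc : IsLocInd G f (2 * m + 5) := by
    refine ⟨fun j hj => ?_, fun j hj => ?_⟩
    · obtain rfl | rfl | ⟨i, rfl⟩ : j = 0 ∨ j = 1 ∨ ∃ i, j = i + 2 := by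
        rcases j with _ | _ | i <;> simp
      · exact ww'.symm
      · rw [f1, fs 0 (by omega)]; exact sw.symm
      · rcases (by omega : i < 2 * m + 1 ∨ i = 2 * m + 1 ∨ i = 2 * m + 2) with h | rfl | rfl
        · rw [fs i h.le, show i + 2 + 1 = i + 1 + 2 by omega, fs _ h]; exact hadj i h
        · rw [fs _ le_rfl, f4]; exact bc.symm
        · rw [f4, f5]; exact ab.symm
    · obtain rfl | rfl | ⟨i, rfl⟩ : j = 0 ∨ j = 1 ∨ ∃ i, j = i + 2 := by
        rcases j with _ | _ | i <;> simp
      · rw [f0, fs 0 (by omega)]; exact sw'.symm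
      · rw [f1, fs 1 (by omega)]; exact ws
      · rw [fs i (by omega)]
        refine L.far_of_level ?_
        rw [hs i (by omega)]
        rcases (by omega : i + 2 ≤ 2 * m + 1 ∨ i + 2 = 2 * m + 2 ∨ i + 2 = 2 * m + 3)
          with h | h | h
        · rw [fs _ h, hs _ h]
        · rw [h, f4]; omega
        · rw [h, f5]; omega
  refine ⟨m + 1, by omega, T_isIndContained hG.1 (w := f) (l := l) (m := d) (by omega) hloc
    ?_ ?_ ?_ ?_ ?_ ?_⟩
  · rw [fs 0 (by omega)]; exact sl.symm
  · exact lw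
  · rw [fs 1 (by omega)]; exact ls
  · rw [show 2 * (m + 1) + 1 = 2 * m + 1 + 2 by omega, fs _ le_rfl]; exact cd.symm
  · rw [show 2 * (m + 1) = 2 * m + 2 by omega, fs _ (by omega)]
    exact (L.far_of_level (by rw [hs _ (by omega)]; omega)).symm
  · rw [show 2 * (m + 1) + 2 = 2 * m + 4 by omega, f4]; exact bd.symm

/-- In the presence of a hub at the first layer, `x` may not be close to a path descending to a
branching vertex at odd level. -/
theorem exists_T_or_G₂ (hG : IsPtolemaic G) (L : Layering G x y x' y' ℓ) {s : ℕ → V} {n : ℕ}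
    (hn : Odd n) (hs : ∀ k ≤ n, ℓ (s k) = k) (hadj : ∀ k < n, G.Adj (s k) (s (k + 1)))
    {h z a b d : V} (hh : ℓ h = 0) (hz : G.Adj h z) (zx : Far G z x) (zy : Far G z y)
    (xs : ¬ Far G x (s 1))
    (ab : G.Adj a b) (bc : G.Adj b (s n)) (cd : G.Adj (s n) d) (ha : ℓ a = n + 2)
    (hb : ℓ b = n + 1) (hd : ℓ d = n + 1) (bd : Far G b d) :
    (∃ k, 1 ≤ k ∧ (T k).IsIndContained G) ∨ G₂.IsIndContained G := by
  have hn1 : 1 ≤ n := hn.pos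
  have hs1 : ℓ (s 1) = 1 := hs 1 hn1
  have hx : ℓ x = 1 := L.level_left hh
  have hxy := (L.zero_iff h).1 hh
  have ys : Far G y (s 1) := (L.far_or_far (u := s 1) (by omega)).resolve_left xs
  have xs' : x = s 1 ∨ G.Adj x (s 1) := by
    by_contra h; exact xs (by simpa [Far, not_or] using h)
  have hs' : G.Adj h (s 1) := by
    rcases xs' with h' | h'
    · exact h' ▸ hxy.1.symm
    · exact L.parent_adj hG 0 hh (by omega) (by omega) h' hxy.1.symm
  by_cases zs : Far G z (s 1)
  · left
    -- The descent is rerouted to end in `h`, where `y, y'` serves as tail and `z` as leaf.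
    let t : ℕ → V := fun k => if k = 0 then h else s k
    have t1 : ∀ k, 1 ≤ k → t k = s k := fun k hk => if_neg (by omega)
    have tn := t1 n hn1
    refine L.exists_T hG hn (s := t) (w := y) (w' := y') (l := z) (a := a) (b := b) (d := d)
      (fun k hk => ?_) (fun k hk => ?_) hxy.2.symm L.adj_right (L.far_right h hh) ?_ hz zy ?_ ab
      (tn ▸ bc) (tn ▸ cd) ha hb hd bd
    · by_cases h0 : k = 0
      · subst h0; exact hh
      · rw [t1 k (by omega)]; exact hs k hk
    · by_cases h0 : k = 0
      · subst h0; exact hs'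
      · rw [t1 k (by omega), t1 _ (by omega)]; exact hadj k hk
    · rwa [t1 1 le_rfl]
    · rwa [t1 1 le_rfl]
  · right
    -- Now `h` and `s 1` have the non-adjacent common neighbours `z` and `x`, with `x'` hanging on
    -- `x`: the centre of a G₂.
    have zne : z ≠ s 1 := by
      rintro rfl
      exact xs zx.symm
    have zs' : G.Adj z (s 1) := by
      by_contra h; exact zs ⟨zne, h⟩
    have xs'' : G.Adj x (s 1) := xs'.resolve_left (by rintro rfl; exact zx.2 zs')
    have main : ∃ e f, G.Adj (s 1) e ∧ G.Adj e f ∧ ℓ e = 2 ∧ ℓ f = 3 := by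
      rcases (by omega : n = 1 ∨ n = 2 ∨ 3 ≤ n) with rfl | rfl | h3
      · exact ⟨b, a, bc.symm, ab.symm, hb, ha⟩
      · exact absurd hn (by decide)
      · exact ⟨s 2, s 3, hadj 1 (by omega), hadj 2 (by omega), hs 2 (by omega), hs 3 (by omega)⟩
    obtain ⟨e, f, se, ef, he, hf⟩ := main
    exact G₂_isIndContained hG (q₀ := y') (q₁ := y) (q₂ := h) (q₃ := s 1) (q₄ := e) (q₅ := f)
      (r := z) (s := x) (t := x') L.adj_right.symm hxy.2 hs' se ef (L.far_right h hh).symm ys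
      (L.far_of_level (by omega)) (L.far_of_level (by omega)) hz zs'.symm hxy.1.symm xs''.symm zx
      L.adj_left (L.far_left h hh).symm

/-- Branching vertices lie on even layers. -/
theorem even_of_branching (hG : IsPtolemaic G) (L : Layering G x y x' y' ℓ)
    (hT : ∀ k, 1 ≤ k → IndFree (T k) G) (hG₂ : IndFree G₂ G)
    (hub : (∀ h x y z x' y', ¬ IsHub G h x y z x' y') ∨
      ∃ h z, ℓ h = 0 ∧ G.Adj h z ∧ Far G z x ∧ Far G z y)
    {a b c d : V} (ab : G.Adj a b) (bc : G.Adj b c) (cd : G.Adj c d) (ha : ℓ a = ℓ c + 2)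
    (hb : ℓ b = ℓ c + 1) (hd : ℓ d = ℓ c + 1) (bd : Far G b d) : Even (ℓ c) := by
  by_contra hodd
  rw [Nat.not_even_iff_odd] at hodd
  have hc1 := hodd.pos
  rcases hub with hub | ⟨h, z, hh, hz, zx, zy⟩
  · obtain ⟨p, p₁, -, hp, pc, -, pp₁, p₁c, -⟩ := L.exists_leg hG (c := c) (by omega) rfl (.inl rfl)
    exact hub c b p d a p₁ ⟨bc.symm, pc.symm, cd, (L.far_of_level (by omega)).symm, bd,
      L.far_of_level (by omega), ab.symm, pp₁, L.far_of_level (by omega), p₁c.symm⟩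
  · obtain ⟨s, s0, s1, s2⟩ := L.exists_descent (ℓ c) c rfl
    have done : ¬ ((∃ k, 1 ≤ k ∧ (T k).IsIndContained G) ∨ G₂.IsIndContained G) := by
      rintro (⟨k, hk, h⟩ | h)
      · exact hT k hk h
      · exact hG₂ h
    have bc' : G.Adj b (s (ℓ c)) := s0.symm ▸ bc
    have cd' : G.Adj (s (ℓ c)) d := s0.symm ▸ cd
    by_cases xs : Far G x (s 1)
    · by_cases ys : Far G y (s 1)
      · have h0 := (L.zero_iff (s 0)).1 (s1 0 (by omega))
        exact done (.inl (L.exists_T hG hodd s1 s2 h0.1.symm L.adj_left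
          (L.far_left _ (s1 0 (by omega))) xs h0.2.symm L.far.symm ys ab bc' cd' ha hb hd bd))
      · exact done (L.symm.exists_T_or_G₂ hG hodd s1 s2 hh hz zy zx ys ab bc' cd' ha hb hd bd)
    · exact done (L.exists_T_or_G₂ hG hodd s1 s2 hh hz zx zy xs ab bc' cd' ha hb hd bd)

end Layering

/-- The vertex `c` has a child `b` that is not adjacent to `d`, and `b` has a child. -/
def HasPrivateBranch (G : SimpleGraph V) (ℓ : V → ℕ) (d c : V) : Prop :=
  ∃ a b, G.Adj a b ∧ G.Adj b c ∧ ℓ a = ℓ c + 2 ∧ ℓ b = ℓ c + 1 ∧ ¬ G.Adj b d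

/-- The vertex `c` has a neighbour `b` in its layer that is not adjacent to `d`, and `b` has a
child that is not adjacent to `c`. -/
def HasPrivateSibling (G : SimpleGraph V) (ℓ : V → ℕ) (d c : V) : Prop :=
  ∃ a b, G.Adj a b ∧ G.Adj b c ∧ ℓ a = ℓ c + 1 ∧ ℓ b = ℓ c ∧ Far G b d ∧ Far G a c

/-- The condition deciding the direction of the edge `dc` inside a layer. -/
def flatArc (G : SimpleGraph V) (ℓ : V → ℕ) (d c : V) : Prop :=
  HasPrivateBranch G ℓ d c ∨ HasPrivateSibling G ℓ c d

/-- Edges between the layers `i` and `i + 1` are directed upwards if `i ≡ 0, 1 (mod 4)`. -/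
def goesUp (i : ℕ) : Prop := i % 4 = 0 ∨ i % 4 = 1

/-- The orientation determined by the layers. -/
def layerArc (G : SimpleGraph V) (ℓ : V → ℕ) (u v : V) : Prop :=
  (ℓ v = ℓ u + 1 ∧ goesUp (ℓ u)) ∨ (ℓ u = ℓ v + 1 ∧ ¬ goesUp (ℓ v)) ∨
    (ℓ u = ℓ v ∧ ((¬ goesUp (ℓ u + 1) ∧ flatArc G ℓ u v) ∨ (goesUp (ℓ u + 1) ∧ flatArc G ℓ v u)))

theorem layerArc_of_up {G : SimpleGraph V} {ℓ : V → ℕ} {u v : V} (h : ℓ v = ℓ u + 1) :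
    layerArc G ℓ u v ↔ goesUp (ℓ u) := by
  simp only [layerArc, h, true_and]
  constructor
  · rintro (h | ⟨h, -⟩ | ⟨h, -⟩)
    · exact h
    · omega
    · omega
  · exact Or.inl

theorem layerArc_of_down {G : SimpleGraph V} {ℓ : V → ℕ} {u v : V} (h : ℓ u = ℓ v + 1) :
    layerArc G ℓ u v ↔ ¬ goesUp (ℓ v) := by
  simp only [layerArc, h, true_and]
  constructor
  · rintro (⟨h, -⟩ | h | ⟨h, -⟩)
    · omega
    · exact h
    · omega
  · exact fun h => .inr (.inl h)

theorem layerArc_of_flat {G : SimpleGraph V} {ℓ : V → ℕ} {u v : V} (h : ℓ u = ℓ v) :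
    layerArc G ℓ u v ↔ (¬ goesUp (ℓ v + 1) ∧ flatArc G ℓ u v) ∨
      (goesUp (ℓ v + 1) ∧ flatArc G ℓ v u) := by
  simp only [layerArc, h, true_and]
  constructor
  · rintro (⟨h, -⟩ | ⟨h, -⟩ | h)
    · omega
    · omega
    · exact h
  · exact fun h => .inr (.inr h)

/-! ### The layer orientation is well defined and opposing. -/

namespace Layering

variable {G : SimpleGraph V} {x y x' y' : V} {ℓ : V → ℕ}

/-- The two branches close up to G₂ in layer 0, with `x` and `y` as the common neighbours, and to G₁
in higher layers, where a common parent supplies the third leg. -/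
theorem not_branch_branch (hG : IsPtolemaic G) (L : Layering G x y x' y' ℓ)
    (hG₁ : IndFree G₁ G) (hG₂ : IndFree G₂ G) {c d : V} (cd : G.Adj c d) (hcd : ℓ c = ℓ d)
    (h : HasPrivateBranch G ℓ d c) (h' : HasPrivateBranch G ℓ c d) : False := by
  obtain ⟨a, b, ab, bc, ha, hb, bd⟩ := h
  obtain ⟨a', b', ab', bd', ha', hb', bc'⟩ := h'
  have ac : Far G c a := L.far_of_level (by omega)
  have ad' : Far G d a' := L.far_of_level (by omega)
  rcases Nat.eq_zero_or_pos (ℓ c) with h0 | h0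
  · have hc := (L.zero_iff c).1 h0
    have hd := (L.zero_iff d).1 (hcd ▸ h0)
    exact hG₂ (G₂_isIndContained hG ab bc cd bd'.symm ab'.symm ac.symm
      (far_of_not_adj (ℓ := ℓ) (by omega) bd)
      (far_of_not_adj (ℓ := ℓ) (by omega) fun h => bc' h.symm) ad' hc.2.symm hd.2.symm hc.1.symm
      hd.1.symm L.far.symm L.adj_left (L.far_left c h0).symm)
  · obtain ⟨p, p₁, p₂, hp, pc, pd, pp₁, p₁c, p₁d, p₁p₂, pp₂⟩ :=
      L.exists_leg hG (c := c) (by omega) hcd (.inr cd)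
    exact hG₁ (G₁_isIndContained hG.1 cd pd.symm pc.symm bc.symm ab.symm bd
      (L.far_of_level (by omega)).symm.2 ac bd'.symm ab'.symm bc'
      (L.far_of_level (by omega)).symm.2 ad' pp₁ p₁p₂ p₁c.2 p₁d.2 pp₂)

/-- A parent `p` of `c` sees `b` and `d` too, so the edge `pc`, continued by a leg below and the
branch above, is the middle of a G₂. -/
theorem not_branch_sibling (hG : IsPtolemaic G) (L : Layering G x y x' y' ℓ)
    (hG₂ : IndFree G₂ G) {c d : V} (cd : G.Adj c d) (hcd : ℓ c = ℓ d)
    (h : HasPrivateBranch G ℓ d c) (h' : HasPrivateSibling G ℓ d c) : False := by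
  obtain ⟨f, e, fe, ec, hf, he, ed⟩ := h
  obtain ⟨a, b, ab, bc, ha, hb, bd, ac⟩ := h'
  have h0 : ℓ c ≠ 0 := by
    intro h0
    rcases L.clique hG.1 (p := b) (q := d) (by omega) (by omega) with h | h
    · exact bd.1 h
    · exact bd.2 h
  obtain ⟨p, p₁, p₂, hp, pc, -, pp₁, p₁c, -, p₁p₂, pp₂⟩ :=
    L.exists_leg hG (c := c) h0 rfl (.inl rfl)
  have pd := L.parent_adj hG _ rfl hp hcd cd pc
  have pb := L.parent_adj hG _ rfl hp hb.symm bc.symm pc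
  exact hG₂ (G₂_isIndContained hG p₁p₂.symm pp₁.symm pc ec.symm fe.symm pp₂.symm p₁c
    (L.far_of_level (by omega)) (L.far_of_level (by omega)) pd cd pb bc.symm bd.symm ab.symm
    (L.far_of_level (by omega)).symm)

theorem flatArc_asymm (hG : IsPtolemaic G) (L : Layering G x y x' y' ℓ)
    (hG₁ : IndFree G₁ G) (hG₂ : IndFree G₂ G) {c d : V} (cd : G.Adj c d) (hcd : ℓ c = ℓ d)
    (h : flatArc G ℓ d c) (h' : flatArc G ℓ c d) : False := by
  rcases h with h | h <;> rcases h' with h' | h'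
  · exact L.not_branch_branch hG hG₁ hG₂ cd hcd h h'
  · exact L.not_branch_sibling hG hG₂ cd hcd h h'
  · exact L.not_branch_sibling hG hG₂ cd.symm hcd.symm h' h
  -- Two private siblings would give an induced P₄ inside one layer.
  · obtain ⟨a, b, -, bd, -, hb, bc, -⟩ := h
    obtain ⟨a', b', -, bc', -, hb', bd', -⟩ := h'
    exact L.no_flat_path hG bd cd.symm bc'.symm bc bd'.symm hb hcd.symm hb'.symm

theorem layerArc_asymm (hG : IsPtolemaic G) (L : Layering G x y x' y' ℓ)
    (hG₁ : IndFree G₁ G) (hG₂ : IndFree G₂ G) {u v : V} (uv : G.Adj u v)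
    (h : layerArc G ℓ u v) : ¬ layerArc G ℓ v u := by
  have h1 := L.le _ _ uv
  have h2 := L.le _ _ uv.symm
  rcases (by omega : ℓ v = ℓ u + 1 ∨ ℓ u = ℓ v + 1 ∨ ℓ u = ℓ v) with h3 | h3 | h3
  · rw [layerArc_of_up h3] at h
    rw [layerArc_of_down h3]
    exact not_not.2 h
  · rw [layerArc_of_down h3] at h
    rwa [layerArc_of_up h3]
  · have := L.flatArc_asymm hG hG₁ hG₂ uv h3
    rw [layerArc_of_flat h3] at h
    rw [layerArc_of_flat h3.symm, h3]
    tauto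

theorem layerArc_opposing (hG : IsPtolemaic G) (L : Layering G x y x' y' ℓ)
    (hbr : ∀ {a b c d : V}, G.Adj a b → G.Adj b c → G.Adj c d → ℓ a = ℓ c + 2 → ℓ b = ℓ c + 1 →
      ℓ d = ℓ c + 1 → Far G b d → Even (ℓ c))
    {a b c d : V} (hP : IsInducedP4 G a b c d) :
    (layerArc G ℓ a b ∧ layerArc G ℓ d c) ∨ (layerArc G ℓ b a ∧ layerArc G ℓ c d) := by
  -- the paths whose first edge goes down
  have main : ∀ {a b c d : V}, IsInducedP4 G a b c d → ℓ a = ℓ b + 1 →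
      (layerArc G ℓ a b ∧ layerArc G ℓ d c) ∨ (layerArc G ℓ b a ∧ layerArc G ℓ c d) := by
    intro a b c d ⟨nac, nad, nbd, ab, bc, cd, ac, ad, bd⟩ h
    have fac : Far G a c := ⟨nac, ac⟩
    have fbd : Far G b d := ⟨nbd, bd⟩
    rw [layerArc_of_down h, layerArc_of_up h]
    have b1 := L.le _ _ bc
    have b2 := L.le _ _ bc.symm
    have c1 := L.le _ _ cd
    have c2 := L.le _ _ cd.symm
    rcases (by omega : ℓ c = ℓ b + 1 ∨ ℓ b = ℓ c + 1 ∨ ℓ b = ℓ c) with hbc | hbc | hbc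
    -- The path turns at `b`; on an even layer, `goesUp` has the same value there and one layer
    -- higher.
    · have hd := L.level_up hG bc cd fbd hbc
      have he := hbr cd.symm bc.symm ab.symm (by omega) hbc h fac.symm
      rw [layerArc_of_down hd, layerArc_of_up hd]
      simp only [goesUp]
      rw [Nat.even_iff] at he
      omega
    · rcases (by omega : ℓ d = ℓ c + 1 ∨ ℓ c = ℓ d + 1 ∨ ℓ c = ℓ d) with hcd | hcd | hcd
      · have he := hbr ab bc cd (by omega) hbc hcd fbd
        rw [layerArc_of_down hcd, layerArc_of_up hcd]
        simp only [goesUp]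
        rw [Nat.even_iff] at he
        omega
      · rw [layerArc_of_up hcd, layerArc_of_down hcd]
        simp only [goesUp]
        omega
      · have hf : flatArc G ℓ d c := .inl ⟨a, b, ab, bc, by omega, hbc, bd⟩
        rw [layerArc_of_flat hcd, layerArc_of_flat hcd.symm, hbc, hcd]
        by_cases hu : goesUp (ℓ d + 1) <;> simp [hu, hf]
    · rcases (by omega : ℓ d = ℓ c + 1 ∨ ℓ c = ℓ d + 1 ∨ ℓ c = ℓ d) with hcd | hcd | hcd
      · rw [layerArc_of_down hcd, layerArc_of_up hcd, hbc]
        exact (em (goesUp (ℓ c))).symm.imp (fun h => ⟨h, h⟩) fun h => ⟨h, h⟩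
      · have := L.level_up hG cd.symm bc.symm fbd.symm hcd
        omega
      · have hf : flatArc G ℓ c d := .inr ⟨a, b, ab, bc, by omega, hbc, fbd, fac⟩
        have h0 : ℓ b ≠ 0 := by
          intro h0
          rcases L.clique hG.1 h0 (q := d) (by omega) with h | h
          · exact nbd h
          · exact bd h
        obtain ⟨p, pb, hp⟩ := L.parent b (ℓ b - 1) (by omega)
        have pc := L.parent_adj hG _ rfl (by omega) hbc bc pb
        have pd := L.parent_adj hG _ rfl (by omega) hcd cd pc
        -- The common parent `p` branches to `b` and `d`, so the layer of `d` is odd and `goesUp`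
        -- changes from it to the next.
        have he := hbr ab pb.symm pd (by omega) (by omega) (by omega) fbd
        have hup : goesUp (ℓ d) ↔ ¬ goesUp (ℓ d + 1) := by
          simp only [goesUp]
          rw [Nat.even_iff] at he
          omega
        rw [layerArc_of_flat hcd, layerArc_of_flat hcd.symm, hbc, hcd]
        tauto
  have ⟨nac, nad, nbd, ab, bc, cd, ac, ad, bd⟩ := hP
  have fac : Far G a c := ⟨nac, ac⟩
  have fbd : Far G b d := ⟨nbd, bd⟩
  have a1 := L.le _ _ ab
  have a2 := L.le _ _ ab.symm
  have b1 := L.le _ _ bc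
  have b2 := L.le _ _ bc.symm
  have c1 := L.le _ _ cd
  have c2 := L.le _ _ cd.symm
  by_cases h : ℓ a = ℓ b + 1
  · exact main hP h
  by_cases h' : ℓ d = ℓ c + 1
  · have := main hP.symm h'
    tauto
  -- An induced P₄ must have an end above its neighbour: any upward step propagates to an end, and a
  -- path inside one layer is impossible.
  exfalso
  rcases (by omega : ℓ b = ℓ a + 1 ∨ ℓ a = ℓ b) with hab | hab
  · have := L.level_up hG ab bc fac hab
    have := L.level_up hG bc cd fbd this
    omega
  rcases (by omega : ℓ c = ℓ b + 1 ∨ ℓ b = ℓ c + 1 ∨ ℓ b = ℓ c) with hbc | hbc | hbc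
  · have := L.level_up hG bc cd fbd hbc
    omega
  · have := L.level_up hG bc.symm ab.symm fac.symm hbc
    omega
  · rcases (by omega : ℓ c = ℓ d + 1 ∨ ℓ c = ℓ d) with hcd | hcd
    · have := L.level_up hG cd.symm bc.symm fbd.symm hcd
      omega
    · exact L.no_flat_path hG ab bc cd fac fbd hab hbc hcd

theorem isGeneralizedOppositionGraph (hG : IsPtolemaic G) (L : Layering G x y x' y' ℓ)
    (hT : ∀ k, 1 ≤ k → IndFree (T k) G) (hG₁ : IndFree G₁ G) (hG₂ : IndFree G₂ G)
    (hub : (∀ h x y z x' y', ¬ IsHub G h x y z x' y') ∨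
      ∃ h z, ℓ h = 0 ∧ G.Adj h z ∧ Far G z x ∧ Far G z y) :
    IsGeneralizedOppositionGraph G :=
  isGeneralizedOppositionGraph_of_rel (layerArc G ℓ)
    (fun _ _ uv h => L.layerArc_asymm hG hG₁ hG₂ uv h)
    fun _ _ _ _ hP => L.layerArc_opposing hG (L.even_of_branching hG hT hG₂ hub) hP

end Layering

/-! ### Existence of a layering and reduction to connected graphs. -/

theorem exists_layering {G : SimpleGraph V} (hG : IsPtolemaic G) (hconn : G.Connected)
    {h x y x' y' : V} (hx : G.Adj h x) (hy : G.Adj h y) (xy : Far G x y) (xx' : G.Adj x x')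
    (yy' : G.Adj y y') (hx' : Far G h x') (hy' : Far G h y') :
    ∃ ℓ : V → ℕ, ℓ h = 0 ∧ Layering G x y x' y' ℓ := by
  let S : V → Set ℕ := fun v => {n | ∃ q, G.Adj x q ∧ G.Adj y q ∧ G.dist q v = n}
  have hS : ∀ v, (S v).Nonempty := fun v => ⟨_, h, hx.symm, hy.symm, rfl⟩
  have hmem : ∀ v, ∃ q, G.Adj x q ∧ G.Adj y q ∧ G.dist q v = sInf (S v) := fun v =>
    Nat.sInf_mem (hS v)
  have hle : ∀ v q, G.Adj x q → G.Adj y q → sInf (S v) ≤ G.dist q v := fun v q h1 h2 =>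
    Nat.sInf_le ⟨q, h1, h2, rfl⟩
  have hlip : ∀ u v, G.Adj u v → sInf (S v) ≤ sInf (S u) + 1 := by
    intro u v uv
    obtain ⟨q, q1, q2, q3⟩ := hmem u
    have h1 := hle v q q1 q2
    have h2 : G.dist q v ≤ G.dist q u + G.dist u v := hconn.dist_triangle
    rw [SimpleGraph.dist_eq_one_iff_adj.2 uv, q3] at h2
    omega
  have hzero : ∀ v, sInf (S v) = 0 ↔ G.Adj x v ∧ G.Adj y v := by
    intro v
    constructor
    · intro h0
      obtain ⟨q, q1, q2, q3⟩ := hmem v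
      rw [h0, hconn.dist_eq_zero_iff] at q3
      exact q3 ▸ ⟨q1, q2⟩
    · rintro ⟨h1, h2⟩
      have := hle v v h1 h2
      rw [SimpleGraph.dist_self] at this
      omega
  -- a common neighbour of `x` and `y` is not adjacent to `x'`
  have away : ∀ {x y x'}, Far G x y → G.Adj h x → G.Adj h y → G.Adj x x' → Far G h x' → ∀ q,
      G.Adj x q ∧ G.Adj y q → Far G q x' := by
    intro x y x' xy hx hy xx' hx' q ⟨xq, yq⟩
    have hyx' : Far G y x' := far_path₄ hG.1 hy.symm hx xx' xy.symm hx'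
    have qx : q ≠ x' := by rintro rfl; exact hyx'.2 yq
    by_cases hq : h = q
    · exact hq ▸ hx'
    have hq' : G.Adj h q := by
      by_contra h'
      exact no_cycle₄ hG.1 hx xq yq.symm hy.symm ⟨hq, h'⟩ xy
    exact ⟨qx, fun qx' => hG.no_gem hy.symm hx xx' xy.symm hx' yq.symm hq'.symm xq.symm qx'⟩
  refine ⟨fun v => sInf (S v), (hzero h).2 ⟨hx.symm, hy.symm⟩, xy, xx', yy', hzero,
    fun q hq => away xy hx hy xx' hx' q ((hzero q).1 hq),
    fun q hq => away xy.symm hy hx yy' hy' q ((hzero q).1 hq).symm, hlip, fun v n hv => ?_⟩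
  obtain ⟨q, q1, q2, q3⟩ := hmem v
  obtain ⟨p, hp⟩ := hconn.exists_walk_length_eq_dist v q
  rw [SimpleGraph.dist_comm, q3] at hp
  change sInf (S v) = n + 1 at hv
  -- The second vertex of a shortest walk from `v` to the nearest common neighbour is a parent of
  -- `v`.
  cases p with
  | nil => simp at hp; omega
  | @cons _ u _ vu p =>
    refine ⟨u, vu.symm, ?_⟩
    have h1 := hlip u v vu.symm
    have h2 := hle u q q1 q2
    have h3 := SimpleGraph.dist_le p
    rw [SimpleGraph.dist_comm] at h3
    simp only [SimpleGraph.Walk.length_cons] at hp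
    change sInf (S u) = n
    omega

/-! ### The main theorem -/

/-- The layering is started at a hub whenever one exists, so that afterwards either there is no hub
at all or layer 0 contains one. -/
theorem isGeneralizedOppositionGraph_of_connected {G : SimpleGraph V} (hG : IsPtolemaic G)
    (hconn : G.Connected) (hT : ∀ k, 1 ≤ k → IndFree (T k) G) (hG₁ : IndFree G₁ G)
    (hG₂ : IndFree G₂ G) : IsGeneralizedOppositionGraph G := by
  by_cases hub : ∃ h x y z x' y', IsHub G h x y z x' y'
  · obtain ⟨h, x, y, z, x', y', hx, hy, hz, xy, xz, yz, xx', yy', hx', hy'⟩ := hub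
    obtain ⟨ℓ, h0, L⟩ := exists_layering hG hconn hx hy xy xx' yy' hx' hy'
    exact L.isGeneralizedOppositionGraph hG hT hG₁ hG₂ (.inr ⟨h, z, h0, hz, xz.symm, yz.symm⟩)
  push Not at hub
  by_cases fork : ∃ h x y x' y', G.Adj h x ∧ G.Adj h y ∧ Far G x y ∧ G.Adj x x' ∧ G.Adj y y' ∧
      Far G h x' ∧ Far G h y'
  · obtain ⟨h, x, y, x', y', hx, hy, xy, xx', yy', hx', hy'⟩ := fork
    obtain ⟨ℓ, h0, L⟩ := exists_layering hG hconn hx hy xy xx' yy' hx' hy'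
    exact L.isGeneralizedOppositionGraph hG hT hG₁ hG₂ (.inl hub)
  -- Without a fork every end-edge points inwards; an edge that is an end-edge in both directions
  -- would itself create a fork.
  refine isGeneralizedOppositionGraph_of_rel (fun u v => ∃ c d, IsInducedP4 G u v c d) ?_ ?_
  · rintro u v uv ⟨c, d, nuc, -, nvd, -, vc, cd, uc, -, vd⟩ ⟨c', d', nvc', -, -, -, uc', -, vc', -⟩
    exact fork ⟨v, c, u, d, c', vc, uv.symm, ⟨nuc.symm, fun h => uc h.symm⟩, cd, uc', ⟨nvd, vd⟩,
      ⟨nvc', vc'⟩⟩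
  · exact fun a b c d hP => .inl ⟨⟨c, d, hP⟩, ⟨b, a, hP.symm⟩⟩

theorem isGeneralizedOppositionGraph_of_induce_supp {G : SimpleGraph V}
    (h : ∀ C : G.ConnectedComponent, IsGeneralizedOppositionGraph (G.induce C.supp)) :
    IsGeneralizedOppositionGraph G := by
  choose D hD hO using h
  have hmem : ∀ {u v}, G.Adj u v → v ∈ (G.connectedComponentMk u).supp := fun uv =>
    SimpleGraph.ConnectedComponent.sound uv.symm.reachable
  refine isGeneralizedOppositionGraph_of_rel (fun u v => ∃ (C : G.ConnectedComponent)
    (hu : u ∈ C.supp) (hv : v ∈ C.supp), (D C).Adj ⟨u, hu⟩ ⟨v, hv⟩) ?_ ?_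
  · rintro u v - ⟨C, hu, hv, h⟩ ⟨C', hv', hu', h'⟩
    obtain rfl : C = C' := hu.symm.trans hu'
    exact (hD C).not_adj_symm h h'
  · intro a b c d hP
    have ha : a ∈ (G.connectedComponentMk a).supp := rfl
    have hb := hmem hP.2.2.2.1
    have hc : c ∈ (G.connectedComponentMk a).supp := (hmem hP.2.2.2.2.1).trans hb
    have hd : d ∈ (G.connectedComponentMk a).supp := (hmem hP.2.2.2.2.2.1).trans hc
    have hP' : IsInducedP4 (G.induce (G.connectedComponentMk a).supp)
        ⟨a, ha⟩ ⟨b, hb⟩ ⟨c, hc⟩ ⟨d, hd⟩ := by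
      simpa [IsInducedP4] using hP
    rcases hO _ _ _ _ _ hP' with ⟨h1, h2⟩ | ⟨h1, h2⟩
    · exact .inl ⟨⟨_, ha, hb, h1⟩, ⟨_, hd, hc, h2⟩⟩
    · exact .inr ⟨⟨_, hb, ha, h1⟩, ⟨_, hc, hd, h2⟩⟩

theorem IndFree.induce {W : Type*} {H : SimpleGraph W} {G : SimpleGraph V} (h : IndFree H G)
    (s : Set V) : IndFree H (G.induce s) :=
  fun h' => h (h'.trans ⟨SimpleGraph.Embedding.induce s⟩)

theorem isGeneralizedOppositionGraph_of_indFree {G : SimpleGraph V} (hG : IsPtolemaic G)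
    (hT : ∀ k, 1 ≤ k → IndFree (T k) G) (hG₁ : IndFree G₁ G) (hG₂ : IndFree G₂ G) :
    IsGeneralizedOppositionGraph G :=
  isGeneralizedOppositionGraph_of_induce_supp fun C =>
    isGeneralizedOppositionGraph_of_connected
      ⟨fun k hk => (hG.1 k hk).induce _, hG.2.induce _⟩ C.connected_toSimpleGraph
      (fun k hk => (hT k hk).induce _) (hG₁.induce _) (hG₂.induce _)

end OppositionGraph

theorem theorem4p3 {V : Type*} [Finite V] (G : SimpleGraph V)
    (hG : OppositionGraph.IsPtolemaic G) :
    List.TFAE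
      [OppositionGraph.IsOppositionGraph G,
       OppositionGraph.IsGeneralizedOppositionGraph G,
       (OppositionGraph.auxGraph G).IsBipartite,
       (∀ k : ℕ, 1 ≤ k → OppositionGraph.IndFree (OppositionGraph.T k) G) ∧
         OppositionGraph.IndFree OppositionGraph.G₁ G ∧
         OppositionGraph.IndFree OppositionGraph.G₂ G] := by
  tfae_have 1 → 2 := OppositionGraph.IsOppositionGraph.isGeneralized
  tfae_have 2 → 1 := OppositionGraph.IsGeneralizedOppositionGraph.isOppositionGraph hG
  tfae_have 2 ↔ 3 := OppositionGraph.isGeneralizedOppositionGraph_iff_isBipartite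
  tfae_have 2 → 4 := fun h =>
    ⟨fun _ hk hk' => OppositionGraph.not_isGeneralizedOppositionGraph_T hk
        (h.of_isIndContained hk'),
      fun h' => OppositionGraph.not_isGeneralizedOppositionGraph_G₁ (h.of_isIndContained h'),
      fun h' => OppositionGraph.not_isGeneralizedOppositionGraph_G₂ (h.of_isIndContained h')⟩
  tfae_have 4 → 2 := fun h =>
    OppositionGraph.isGeneralizedOppositionGraph_of_indFree hG h.1 h.2.1 h.2.2
  tfae_finish
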